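/- **Definitions.** For a finite set $Y\subset\mathbf R^N$, $[Y]$ denotes its convex hull. A *vertex array* of a polytope $P$ is a listing $x_0<x_1<\dots<x_n$ of all its (distinct) vertices; the vertices of a nonempty face of $P$, listed in increasing order, form the *induced* vertex array of the face. Put $x_t=x_0$ for $t\le 0$ and $x_t=x_n$ for $t\ge n$. For $d\le 2$, a *$d$-braxtope* (with any vertex array) is a $d$-simplex. For $n\ge d\ge 3$, a $d$-polytope with vertex array $x_0<\dots<x_n$ is a *$d$-braxtope* (with this vertex array) if its facets are exactly $T_i=[x_i,x_{i+1},\dots,x_{i+d-1}]$ for $0\le i\le n-d+1$, and $E_j=[x_0,x_{j-(d-2)},\dots,x_{j-1},x_{j+1},\dots,x_{j+(d-2)}]$ for $2\le j\le n$. For $n\ge d\ge 2$, a $d$-polytope with vertex array $x_0<\dots<x_n$ is a *$d$-multiplex* (with this vertex array) if its facets are exactly $[x_{i-d+1},\dots,x_{i-1},x_{i+1},\dots,x_{i+d-1}]$ for $0\le i\le n$. A *vertex figure* of $P$ at a vertex $v$ is the intersection of $P$ with a hyperplane strictly separating $v$ from all other vertices. A *pyramid* over $B$ is $[B\cup\{v\}]$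 with $v\notin\operatorname{aff}B$; a *$k$-fold pyramid* is obtained by iterating this $k$ times. $f_j(P)$ is the number of $j$-dimensional faces of $P$ (with $f_{-1}=f_{\dim P}=1$ counting $\emptyset$ and $P$), and $f_{02}(P)$ is the number of pairs (vertex, $2$-face) with the vertex in the $2$-face. **Theorem.** Let $n\ge d\ge 3$ and let $Q=Q^{d,n}$ be a $d$-braxtope with vertex array $x_0<x_1<\dots<x_n$. Then: 1. $Q$ is braxial: it is a $d$-polytope each of whose nonempty proper faces is a braxtope with the induced vertex array. 2. $Q$ has a vertex figure at $x_0$, and every vertex figure of $Q$ at $x_0$ is a $(d-1)$-multiplex with the induced vertex array $\bar x_1<\dots<\bar x_n$, where $\bar x_u$ is the point in which the segment $[x_0,x_u]$ meets the hyperplane. 3. If $n\le 2d-3$, then $Q$ is a $(2d-2-n)$-fold pyramid over an $(n-d+2)$-braxtope whose vertices are among the $x_i$, with the induced vertex array. 4. For $-1\le j\le d$, $f_j(Q)=\binom{d+1}{j+1}+(n-d)\left[\binom{d-1}{j}+\binom{d-2}{j-1}\right]$, where $\binom ab=0$ if $b<0$. 5. $Q$ is elementary, that is, $f_{02}(Q)-3f_2(Q)+f_1(Q)-d\,f_0(Q)+\binom{d+1}{2}=0$.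 -/

import Mathlib

namespace Braxtope

section

variable {E : Type*} [NormedAddCommGroup E] [NormedSpace ℝ E]

/-- The faces of a convex polytope `P`: the empty set and the sets of maximizers over `P` of
linear functionals. Both `∅` and `P` are (improper) faces. -/
def IsFace (P F : Set E) : Prop := IsExposed ℝ P F

open Classical in
/-- The dimension of a convex set: `-1` for the empty set, and otherwise the dimension of the
affine hull. -/
noncomputable def pdim (S : Set E) : ℤ :=
  if S = ∅ then -1 else (Module.finrank ℝ (affineSpan ℝ S).direction : ℤ)

/-- Facets: the faces of codimension one. -/
def IsFacet (P F : Set E) : Prop := IsFace P F ∧ pdim F = pdim P - 1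

/-- The vertices of `P`: the points `v` such that `{v}` is a face. -/
def vertices (P : Set E) : Set E := {v | IsFace P {v}}

/-- `x 0 < x 1 < ⋯ < x n` is a vertex array of the convex polytope `P`: the points `x i` are
distinct, they are exactly the vertices of `P`, and `P` is their convex hull. -/
structure IsVertexArray (P : Set E) {n : ℕ} (x : Fin (n + 1) → E) : Prop where
  injective : Function.Injective x
  vertices_eq : vertices P = Set.range x
  eq_convexHull : P = convexHull ℝ (Set.range x)

/-- The point `x_t` for an arbitrary integer `t`, under the convention `x_t = x_0` for `t ≤ 0`
and `x_t = x_n` for `t ≥ n`. -/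
def vtx {n : ℕ} (x : Fin (n + 1) → E) (t : ℤ) : E :=
  x ⟨min t.toNat n, Nat.lt_succ_of_le (min_le_right _ _)⟩

/-- `T_i = [x_i, x_{i+1}, …, x_{i+d-1}]`. -/
def facetT (d : ℕ) {n : ℕ} (x : Fin (n + 1) → E) (i : ℤ) : Set E :=
  convexHull ℝ (vtx x '' {t : ℤ | i ≤ t ∧ t ≤ i + d - 1})

/-- `E_j = [x_0, x_{j-(d-2)}, …, x_{j-1}, x_{j+1}, …, x_{j+(d-2)}]`. -/
def facetE (d : ℕ) {n : ℕ} (x : Fin (n + 1) → E) (j : ℤ) : Set E :=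
  convexHull ℝ
    (insert (x 0) (vtx x '' {t : ℤ | j - ((d : ℤ) - 2) ≤ t ∧ t ≤ j + ((d : ℤ) - 2) ∧ t ≠ j}))

/-- `P` is a `d`-braxtope with the vertex array `x 0 < x 1 < ⋯ < x n`: a `d`-simplex if `d ≤ 2`,
and for `d ≥ 3` a `d`-polytope whose facets are exactly `T_i` for `0 ≤ i ≤ n - d + 1` and
`E_j` for `2 ≤ j ≤ n`. -/
def IsBraxtope (d : ℕ) {n : ℕ} (x : Fin (n + 1) → E) (P : Set E) : Prop :=
  IsVertexArray P x ∧ pdim P = d ∧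
    (d ≤ 2 → n = d ∧ AffineIndependent ℝ x) ∧
    (3 ≤ d → d ≤ n ∧
      {F | IsFacet P F} =
        {F | (∃ i : ℤ, 0 ≤ i ∧ i ≤ (n : ℤ) - d + 1 ∧ F = facetT d x i) ∨
          (∃ j : ℤ, 2 ≤ j ∧ j ≤ (n : ℤ) ∧ F = facetE d x j)})

/-- `P` is a `d`-multiplex with the vertex array `x 0 < x 1 < ⋯ < x n`, where `n ≥ d ≥ 2`:
a `d`-polytope whose facets are exactly the sets
`[x_{i-d+1}, …, x_{i-1}, x_{i+1}, …, x_{i+d-1}]` for `0 ≤ i ≤ n`. -/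
def IsMultiplex (d : ℕ) {n : ℕ} (x : Fin (n + 1) → E) (P : Set E) : Prop :=
  2 ≤ d ∧ d ≤ n ∧ IsVertexArray P x ∧ pdim P = d ∧
    {F | IsFacet P F} =
      {F | ∃ i : ℤ, 0 ≤ i ∧ i ≤ (n : ℤ) ∧
        F = convexHull ℝ (vtx x '' {t : ℤ | i - d + 1 ≤ t ∧ t ≤ i + d - 1 ∧ t ≠ i})}

/-- The `d`-polytope `P` is braxial with respect to its vertex array `x`: every proper face is a
braxtope with respect to the induced vertex array, that is, the increasing listing of the `x i`
that are its vertices. (Only nonempty faces have a vertex array.) -/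
def IsBraxial (d : ℕ) {n : ℕ} (x : Fin (n + 1) → E) (P : Set E) : Prop :=
  IsVertexArray P x ∧ pdim P = d ∧
    ∀ F : Set E, IsFace P F → F.Nonempty → F ≠ P →
      ∃ (k m : ℕ) (σ : Fin (m + 1) ↪o Fin (n + 1)), IsBraxtope k (x ∘ σ) F

/-- `S` is a vertex figure of `P` at its vertex `v`: the section of `P` by a hyperplane that
strictly separates `v` from all other vertices. -/
def IsVertexFigure (P : Set E) (v : E) (S : Set E) : Prop :=
  v ∈ vertices P ∧ ∃ (l : E →L[ℝ] ℝ) (c : ℝ),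
    l v < c ∧ (∀ w ∈ vertices P, w ≠ v → c < l w) ∧ S = P ∩ {p | l p = c}

/-- `P` is a pyramid over `B`. -/
def IsPyramid (P B : Set E) : Prop :=
  ∃ v : E, v ∉ affineSpan ℝ B ∧ P = convexHull ℝ (insert v B)

/-- `P` is a `k`-fold pyramid over `B`. -/
def IsFoldPyramid : ℕ → Set E → Set E → Prop
  | 0, P, B => P = B
  | k + 1, P, B => ∃ R : Set E, IsFoldPyramid k R B ∧ IsPyramid P R

/-- `f_j(P)`, the number of `j`-dimensional faces. -/
noncomputable def faceCount (P : Set E) (j : ℤ) : ℕ :=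
  Set.ncard {F : Set E | IsFace P F ∧ pdim F = j}

/-- `f_{i,j}(P)` for `i < j`: the number of pairs `F ⊂ G` of faces with `dim F = i` and
`dim G = j`. -/
noncomputable def flagCount (P : Set E) (i j : ℤ) : ℕ :=
  Set.ncard {p : Set E × Set E | IsFace P p.1 ∧ IsFace P p.2 ∧ p.1 ⊆ p.2 ∧
    pdim p.1 = i ∧ pdim p.2 = j}

/-- The `d`-polytope `P` is elementary. -/
def IsElementary (d : ℕ) (P : Set E) : Prop :=
  (flagCount P 0 2 : ℤ) - 3 * faceCount P 2 + faceCount P 1 - d * faceCount P 0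
    + (d + 1).choose 2 = 0

end

/-- The binomial coefficient with an integer lower index, zero if that index is negative. -/
def binom (a : ℕ) (b : ℤ) : ℕ := if b < 0 then 0 else a.choose b.toNat

end Braxtope

/-!
The proof reduces the five claims to the combinatorics of the index sets of the facets `T_i` and
`E_j`, by means of a small amount of polytope theory.

**Polytopes.** A nonempty face `F` of a polytope that misses a vertex `v` lies in a facet missing
`v`: as long as `F` has codimension at least two, a supporting hyperplane can be rotated about
`F ∪ {v}` until it meets a new vertex (`IsVertexArray.exists_larger_face`,
`IsVertexArray.exists_facet`). Hence the nonempty faces correspond to the nonempty *closed* index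
sets, those that are intersections of facet index sets.

**Braxial.** By induction on the dimension it is enough that every facet is a braxtope. The `T_i`
and `E_n` are simplices. For `2 ≤ j < n`, the prospective facets of `E_j` are intersections of `E_j`
with facets, they form an antichain, and every intersection of `E_j` with another facet lies in one
of them; so they are all the facets (`IsVertexArray.isFacet_iff_of_cover`, `IsBraxtope.facetE`).

**Multifold pyramids.** For `n ≤ 2d - 3` the facet `E_{d-1}` contains every vertex but `x_{d-1}`, so
the braxtope is a pyramid over a `(d-1)`-braxtope with one vertex less; this is iterated
(`IsBraxtope.exists_isFoldPyramid`).

**Face numbers.** As `x_0` is outside the facet `T_a`, for `a ≥ 1`, the points `x_0, x_a, …,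
x_{a+d-1}` form an affine basis, and for `a < j < a + d - 1` the functional that exposes `E_j` is
constant on it except at `x_j`. It follows that a face with least nonzero index `a` has the same
affine span as its *window*, the vertices with indices in `{0} ∪ [a, a+d-1]`
(`IsBraxtope.face_subset_affineSpan`). So a face is determined by its window, and its dimension is
one less than the number of elements of the window. The windows that occur are the *admissible*
sets (`IsClosedIndex.isAdmissible_window`, `IsAdmissible.exists_isClosedIndex`): subsets of
`{0} ∪ [a, a+d-1]` which, if they contain `0` and `2 ≤ a ≤ n - d + 1`, omit `a + d - 2`. Sorting
them by `a` gives the formula (`ncard_isAdmissible`).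

**Elementary.** All two-dimensional faces are triangles, so `f_{02} = 3 f_2`, and the identity
follows from the values of `f_0` and `f_1`.

**Vertex figures.** Projecting from `x_0` identifies the section of a face `[x_0, …]` with the
convex hull of the points cut out on its edges at `x_0`. The facets of the vertex figure are the
sections of the facets through `x_0` (`IsVertexArray.isFacet_section_iff`), namely of `T_0` and of
the `E_j`, and these give exactly the facets of a multiplex.
-/

namespace Braxtope

open Module

section

variable {E : Type*} [NormedAddCommGroup E] [NormedSpace ℝ E]

/-! ### Faces and dimension -/

theorem pdim_of_nonempty {S : Set E} (h : S.Nonempty) :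
    pdim S = finrank ℝ (vectorSpan ℝ S) := by
  rw [pdim, if_neg h.ne_empty, direction_affineSpan]

theorem pdim_empty : pdim (∅ : Set E) = -1 := if_pos rfl

theorem pdim_nonneg {S : Set E} (h : S.Nonempty) : 0 ≤ pdim S := by
  rw [pdim_of_nonempty h]; positivity

theorem pdim_convexHull (S : Set E) : pdim (convexHull ℝ S) = pdim S := by
  rcases S.eq_empty_or_nonempty with rfl | h
  · simp
  · rw [pdim_of_nonempty h, pdim_of_nonempty h.convexHull, ← direction_affineSpan,
      affineSpan_convexHull, direction_affineSpan]

theorem pdim_mono [FiniteDimensional ℝ E] {S T : Set E} (h : S ⊆ T) : pdim S ≤ pdim T := by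
  rcases S.eq_empty_or_nonempty with rfl | hS
  · rcases T.eq_empty_or_nonempty with rfl | hT
    · rfl
    · rw [pdim_empty]; linarith [pdim_nonneg hT]
  · rw [pdim_of_nonempty hS, pdim_of_nonempty (hS.mono h)]
    exact_mod_cast Submodule.finrank_mono (vectorSpan_mono ℝ h)

theorem IsFace.exists_functional {P F : Set E} (h : IsFace P F) (hF : F.Nonempty) :
    ∃ (l : E →L[ℝ] ℝ) (M : ℝ), (∀ p ∈ P, l p ≤ M) ∧ F = {p ∈ P | l p = M} := by
  obtain ⟨l, rfl⟩ := h hF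
  obtain ⟨q, hq, hmax⟩ := hF
  exact ⟨l, l q, hmax, Set.ext fun p => ⟨fun hp => ⟨hp.1, le_antisymm (hmax p hp.1) (hp.2 q hq)⟩,
    fun hp => ⟨hp.1, fun r hr => (hmax r hr).trans hp.2.ge⟩⟩⟩

theorem isFace_of_functional {P : Set E} (l : E →L[ℝ] ℝ) (M : ℝ) (h : ∀ p ∈ P, l p ≤ M) :
    IsFace P {p ∈ P | l p = M} := by
  rintro ⟨q, hq, hqM⟩
  exact ⟨l, Set.ext fun p => ⟨fun hp => ⟨hp.1, fun r hr => (h r hr).trans hp.2.ge⟩,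
    fun hp => ⟨hp.1, le_antisymm (h p hp.1) (hqM ▸ hp.2 q hq)⟩⟩⟩

theorem IsFace.self (P : Set E) : IsFace P P := IsExposed.refl P

/-- A functional that is constant on a set is constant on its affine span. -/
theorem apply_eq_of_mem_affineSpan {S : Set E} (l : E →L[ℝ] ℝ) {M : ℝ} (h : ∀ p ∈ S, l p = M)
    {p : E} (hp : p ∈ affineSpan ℝ S) : l p = M := by
  refine affineSpan_induction (p := fun q => l q = M) hp h fun c u v w hu hv hw => ?_
  simp [hu, hv, hw]

theorem IsFace.mem_of_mem_affineSpan {P F : Set E} (h : IsFace P F) {p : E} (hp : p ∈ P)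
    (hpF : p ∈ affineSpan ℝ F) : p ∈ F := by
  have hF : F.Nonempty := (affineSpan_nonempty ℝ).1 ⟨p, hpF⟩
  obtain ⟨l, M, -, hFe⟩ := h.exists_functional hF
  have := apply_eq_of_mem_affineSpan l (M := M) (fun q hq => by rw [hFe] at hq; exact hq.2) hpF
  rw [hFe]
  exact ⟨hp, this⟩

theorem IsFace.eq_of_pdim_le [FiniteDimensional ℝ E] {P F G : Set E} (hF : IsFace P F)
    (hGP : G ⊆ P) (hFG : F ⊆ G) (h : pdim G ≤ pdim F) : F = G := by
  rcases G.eq_empty_or_nonempty with rfl | hG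
  · exact Set.subset_empty_iff.1 hFG
  rcases F.eq_empty_or_nonempty with rfl | hFn
  · rw [pdim_empty] at h
    linarith [pdim_nonneg hG]
  refine hFG.antisymm fun p hp => hF.mem_of_mem_affineSpan (hGP hp) ?_
  have hle := affineSpan_mono ℝ hFG
  rw [pdim_of_nonempty hFn, pdim_of_nonempty hG] at h
  have hdir : vectorSpan ℝ F = vectorSpan ℝ G :=
    Submodule.eq_of_le_of_finrank_le (vectorSpan_mono ℝ hFG) (by exact_mod_cast h)
  have : affineSpan ℝ F = affineSpan ℝ G :=
    AffineSubspace.eq_of_direction_eq_of_nonempty_of_le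
      (by rw [direction_affineSpan, direction_affineSpan, hdir])
      ((affineSpan_nonempty ℝ).2 hFn) hle
  rw [this]
  exact subset_affineSpan ℝ G hp

theorem IsFace.pdim_lt [FiniteDimensional ℝ E] {P F G : Set E} (hF : IsFace P F)
    (hGP : G ⊆ P) (hFG : F ⊂ G) : pdim F < pdim G :=
  lt_of_not_ge fun h => hFG.ne (hF.eq_of_pdim_le hGP hFG.subset h)

theorem pdim_insert_le [FiniteDimensional ℝ E] {S : Set E} (v : E) :
    pdim (insert v S) ≤ pdim S + 1 := by
  rcases S.eq_empty_or_nonempty with rfl | hS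
  · rw [pdim_of_nonempty (Set.insert_nonempty _ _)]
    simp [pdim_empty]
  · rw [pdim_of_nonempty hS, pdim_of_nonempty (Set.insert_nonempty _ _)]
    exact_mod_cast finrank_vectorSpan_insert_le_set ℝ S v

theorem pdim_insert_of_notMem [FiniteDimensional ℝ E] {S : Set E} {v : E}
    (hv : v ∉ affineSpan ℝ S) : pdim (insert v S) = pdim S + 1 := by
  refine le_antisymm (pdim_insert_le v) ?_
  rcases S.eq_empty_or_nonempty with rfl | hS
  · rw [pdim_empty]; exact pdim_nonneg (Set.insert_nonempty _ _)
  rw [pdim_of_nonempty hS, pdim_of_nonempty (Set.insert_nonempty _ _)]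
  have hlt : affineSpan ℝ S < affineSpan ℝ (insert v S) := by
    refine lt_of_le_of_ne (affineSpan_mono ℝ (Set.subset_insert _ _)) fun he => hv ?_
    rw [he]
    exact subset_affineSpan ℝ _ (Set.mem_insert _ _)
  have := AffineSubspace.direction_lt_of_nonempty hlt ((affineSpan_nonempty ℝ).2 hS)
  rw [direction_affineSpan, direction_affineSpan] at this
  exact_mod_cast Submodule.finrank_lt_finrank_of_lt this

/-! ### Faces of a polytope and their index sets -/

variable {n : ℕ} {x : Fin (n + 1) → E} {P F G : Set E}

theorem IsVertexArray.mem (h : IsVertexArray P x) (i : Fin (n + 1)) : x i ∈ P := by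
  rw [h.eq_convexHull]
  exact subset_convexHull ℝ _ ⟨i, rfl⟩

theorem IsVertexArray.isFace_singleton (h : IsVertexArray P x) (i : Fin (n + 1)) :
    IsFace P {x i} := by
  have : x i ∈ vertices P := h.vertices_eq ▸ ⟨i, rfl⟩
  exact this

theorem IsVertexArray.convexIndependent (h : IsVertexArray P x) : ConvexIndependent ℝ x := by
  have hP : Convex ℝ P := h.eq_convexHull ▸ convex_convexHull ℝ _
  have := hP.convexIndependent_extremePoints
  have hx : ∀ i, x i ∈ P.extremePoints ℝ := fun i =>
    exposedPoints_subset_extremePoints (mem_exposedPoints_iff_exposed_singleton.2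
      (h.isFace_singleton i))
  exact this.comp_embedding (⟨fun i => ⟨x i, hx i⟩, fun i j hij =>
    h.injective (congrArg Subtype.val hij)⟩ : Fin (n + 1) ↪ P.extremePoints ℝ)

theorem IsVertexArray.mem_hull_iff (h : IsVertexArray P x) {A : Set (Fin (n + 1))}
    {i : Fin (n + 1)} : x i ∈ convexHull ℝ (x '' A) ↔ i ∈ A :=
  h.convexIndependent.mem_convexHull_iff A i

theorem IsVertexArray.hull_subset_iff (h : IsVertexArray P x) {A B : Set (Fin (n + 1))} :
    convexHull ℝ (x '' A) ⊆ convexHull ℝ (x '' B) ↔ A ⊆ B :=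
  ⟨fun hs _ hi => h.mem_hull_iff.1 (hs (h.mem_hull_iff.2 hi)),
    fun hs => convexHull_mono (Set.image_mono hs)⟩

theorem IsVertexArray.hull_subset (h : IsVertexArray P x) (A : Set (Fin (n + 1))) :
    convexHull ℝ (x '' A) ⊆ P := by
  rw [h.eq_convexHull]
  exact convexHull_mono (Set.image_subset_range _ _)

/-- A face is the convex hull of the vertices it contains. -/
theorem IsVertexArray.face_eq_hull (h : IsVertexArray P x) (hF : IsFace P F) :
    F = convexHull ℝ (x '' {i | x i ∈ F}) := by
  have hfin : (Set.range x).Finite := Set.finite_range x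
  have hPc : IsCompact P := h.eq_convexHull ▸ hfin.isCompact_convexHull ℝ
  have hP : Convex ℝ P := h.eq_convexHull ▸ convex_convexHull ℝ _
  have hFc : IsCompact F := IsExposed.isCompact hF hPc
  have hFx : Convex ℝ F := IsExposed.convex hF hP
  refine Set.Subset.antisymm ?_ (convexHull_min ?_ hFx)
  · have hext : F.extremePoints ℝ ⊆ x '' {i | x i ∈ F} := by
      intro p hp
      have h1 := (IsExposed.isExtreme hF).extremePoints_subset_extremePoints hp
      have h2 : p ∈ (convexHull ℝ (Set.range x)).extremePoints ℝ := h.eq_convexHull ▸ h1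
      obtain ⟨i, rfl⟩ := extremePoints_convexHull_subset h2
      exact ⟨i, hp.1, rfl⟩
    have hcl := closure_convexHull_extremePoints hFc hFx
    refine hcl.symm.subset.trans (closure_minimal (convexHull_mono hext) ?_)
    exact ((Set.toFinite _).isCompact_convexHull ℝ).isClosed
  · rintro _ ⟨i, hi, rfl⟩
    exact hi

theorem IsVertexArray.exists_mem_face (h : IsVertexArray P x) (hF : IsFace P F)
    (hn : F.Nonempty) : ∃ i, x i ∈ F := by
  rw [h.face_eq_hull hF, convexHull_nonempty_iff, Set.image_nonempty] at hn
  exact hn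

theorem IsVertexArray.face_subset (h : IsVertexArray P x) (hF : IsFace P F) (hG : IsFace P G)
    (hs : ∀ i, x i ∈ F → x i ∈ G) : F ⊆ G := by
  rw [h.face_eq_hull hF, h.face_eq_hull hG]
  exact convexHull_mono (Set.image_mono hs)

/-- A functional bounded by `M` at the vertices cuts out a face. -/
theorem IsVertexArray.isFace_of_vertices (h : IsVertexArray P x) (l : E →L[ℝ] ℝ) (M : ℝ)
    (hl : ∀ i, l (x i) ≤ M) : IsFace P {p ∈ P | l p = M} := by
  refine isFace_of_functional l M fun p hp => ?_
  rw [h.eq_convexHull] at hp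
  have : convexHull ℝ (Set.range x) ⊆ {q | l q ≤ M} :=
    convexHull_min (by rintro _ ⟨i, rfl⟩; exact hl i) (convex_halfSpace_le l.isLinear M)
  exact this hp

/-- A face of a face of a polytope is a face: if `l` exposes `F` in `P` and `g` exposes `G` in `F`,
then `K l + g` exposes `G` in `P` for all large `K`. -/
theorem IsVertexArray.isFace_trans (h : IsVertexArray P x) (hF : IsFace P F) (hG : IsFace F G) :
    IsFace P G := by
  intro hGn
  have hGF : G ⊆ F := IsExposed.subset hG
  obtain ⟨l, M, hl, hFe⟩ := hF.exists_functional (hGn.mono hGF)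
  obtain ⟨g, N, hg, hGe⟩ := hG.exists_functional hGn
  have hK : ∃ K : ℝ, 0 ≤ K ∧ ∀ i, x i ∉ F → K * (l (x i) - M) + (g (x i) - N) < 0 := by
    classical
    obtain ⟨K, hK⟩ := (Set.finite_range fun i => (g (x i) - N + 1) / (M - l (x i))).bddAbove
    refine ⟨max K 0, le_max_right _ _, fun i hi => ?_⟩
    have hlt : l (x i) < M := lt_of_le_of_ne (hl _ (h.mem i)) fun he => hi (by
      rw [hFe]; exact ⟨h.mem i, he⟩)
    have h1 : (g (x i) - N + 1) / (M - l (x i)) ≤ max K 0 := (hK ⟨i, rfl⟩).trans (le_max_left _ _)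
    rw [div_le_iff₀ (by linarith)] at h1
    linarith
  obtain ⟨K, hK0, hK⟩ := hK
  have hb : ∀ i, (K • l + g) (x i) ≤ K * M + N := by
    intro i
    have e : (K • l + g) (x i) = K * l (x i) + g (x i) := rfl
    rw [e]
    by_cases hi : x i ∈ F
    · have h1 := hg _ hi
      rw [hFe] at hi
      rw [hi.2]
      linarith
    · linarith [hK i hi]
  have hface := h.isFace_of_vertices _ _ hb
  have : G = {p ∈ P | (K • l + g) p = K * M + N} := by
    refine Set.Subset.antisymm (fun p hp => ?_) ?_
    · have hpF := hGF hp
      rw [hGe] at hp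
      have h2 := hp.2
      rw [hFe] at hpF
      refine ⟨hpF.1, ?_⟩
      change K * l p + g p = _
      rw [hpF.2, h2]
    · rw [h.face_eq_hull hface]
      refine convexHull_min ?_ (hG.convex (hF.convex (h.eq_convexHull ▸ convex_convexHull ℝ _)))
      rintro _ ⟨i, ⟨-, hi⟩, rfl⟩
      have e : K * l (x i) + g (x i) = K * M + N := hi
      have hiF : x i ∈ F := by
        by_contra hi'
        linarith [hK i hi']
      rw [hGe]
      refine ⟨hiF, ?_⟩
      rw [hFe] at hiF
      rw [hiF.2] at e
      linarith
  exact (this ▸ hface) hGn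

/-! ### Facets -/

/-- A face of codimension at least two that misses the point `v` lies in a strictly larger face
missing `v`: rotate a supporting hyperplane of `F` about the affine hull of `F ∪ {v}` until it hits
a further vertex. -/
theorem IsVertexArray.exists_larger_face [FiniteDimensional ℝ E] (h : IsVertexArray P x)
    (hF : IsFace P F) (hn : F.Nonempty) {v : E} (hv : v ∈ P) (hvF : v ∉ F)
    (hd : pdim F + 1 < pdim P) : ∃ G, IsFace P G ∧ F ⊂ G ∧ v ∉ G := by
  obtain ⟨l, M, hl, hFe⟩ := hF.exists_functional hn
  obtain ⟨p, hp⟩ := hn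
  have hFP : F ⊆ P := IsExposed.subset hF
  have hlt : vectorSpan ℝ (insert v F) < vectorSpan ℝ P := by
    refine lt_of_le_of_ne (vectorSpan_mono ℝ (Set.insert_subset hv hFP)) fun he => ?_
    have h1 := pdim_insert_le (S := F) v
    rw [pdim_of_nonempty (Set.insert_nonempty _ _), he,
      ← pdim_of_nonempty (S := P) ⟨v, hv⟩] at h1
    linarith
  obtain ⟨u, hu, hu'⟩ := Set.exists_of_ssubset hlt
  obtain ⟨g₀, hg₀, hker⟩ := Submodule.exists_le_ker_of_notMem hu'
  -- The functional is constant on `F ∪ {v}` but not on `P`.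
  have hconst : ∀ q ∈ insert v F, g₀ q = g₀ p := by
    intro q hq
    have := hker (vsub_mem_vectorSpan ℝ hq (Set.mem_insert_of_mem v hp))
    rw [LinearMap.mem_ker, vsub_eq_sub, map_sub] at this
    linarith
  have hne : ∃ i, g₀ (x i) ≠ g₀ p := by
    by_contra! hcon
    have hsub : vectorSpan ℝ P ≤ LinearMap.ker g₀ := by
      rw [h.eq_convexHull, ← direction_affineSpan, affineSpan_convexHull, direction_affineSpan,
        vectorSpan_def, Submodule.span_le]
      rintro _ ⟨_, ⟨i, rfl⟩, _, ⟨j, rfl⟩, rfl⟩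
      simp [hcon]
    exact hg₀ (hsub hu)
  have hg : ∃ g : E →L[ℝ] ℝ, (∀ q ∈ insert v F, g q = g p) ∧ ∃ i, g p < g (x i) := by
    obtain ⟨i, hi⟩ := hne
    rcases lt_or_gt_of_ne hi with hi | hi
    · refine ⟨-LinearMap.toContinuousLinearMap g₀, fun q hq => ?_, i, ?_⟩
      · simp [hconst q hq]
      · simpa using hi
    · exact ⟨LinearMap.toContinuousLinearMap g₀, fun q hq => by simp [hconst q hq], i,
        by simpa using hi⟩
  obtain ⟨g, hgc, i₀, hi₀⟩ := hg
  classical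
  obtain ⟨i, hi, hmin⟩ := Finset.exists_min_image
    (Finset.univ.filter fun i => g p < g (x i)) (fun i => (M - l (x i)) / (g (x i) - g p))
    ⟨i₀, by simpa using hi₀⟩
  simp only [Finset.mem_filter, Finset.mem_univ, true_and] at hi hmin
  set t := (M - l (x i)) / (g (x i) - g p) with ht
  have ht0 : 0 ≤ t := div_nonneg (by linarith [hl _ (h.mem i)]) (by linarith)
  have hti : t * (g (x i) - g p) = M - l (x i) := div_mul_cancel₀ _ (by linarith)
  have hb : ∀ k, (l + t • g) (x k) ≤ M + t * g p := by
    intro k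
    change l (x k) + t * g (x k) ≤ _
    by_cases hk : g p < g (x k)
    · have := hmin k hk
      rw [le_div_iff₀ (by linarith)] at this
      linarith
    · have := mul_nonneg ht0 (sub_nonneg.2 (not_lt.1 hk))
      linarith [hl _ (h.mem k)]
  refine ⟨_, h.isFace_of_vertices _ _ hb, ⟨fun q hq => ⟨hFP hq, ?_⟩, fun hsub => ?_⟩, ?_⟩
  · change l q + t * g q = _
    rw [hgc q (Set.mem_insert_of_mem v hq)]
    rw [hFe] at hq
    rw [hq.2]
  · have hiF : x i ∈ F := hsub ⟨h.mem i, by change l (x i) + t * g (x i) = _; linarith⟩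
    exact hi.ne' (hgc _ (Set.mem_insert_of_mem v hiF))
  · rintro ⟨-, hvG⟩
    change l v + t * g v = _ at hvG
    rw [hgc v (Set.mem_insert v F)] at hvG
    exact hvF (by rw [hFe]; exact ⟨hv, by linarith⟩)

/-- Every nonempty proper face is the intersection of facets. -/
theorem IsVertexArray.exists_facet [FiniteDimensional ℝ E] (h : IsVertexArray P x)
    (hF : IsFace P F) (hn : F.Nonempty) {v : E} (hv : v ∈ P) (hvF : v ∉ F) :
    ∃ G, IsFacet P G ∧ F ⊆ G ∧ v ∉ G := by
  induction hk : (pdim P - pdim F).toNat using Nat.strong_induction_on generalizing F with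
  | _ k ih =>
    have hFP : F ⊆ P := IsExposed.subset hF
    have hlt : pdim F < pdim P := hF.pdim_lt Set.Subset.rfl ⟨hFP, fun hs => hvF (hs hv)⟩
    by_cases hd : pdim F + 1 < pdim P
    · obtain ⟨G, hG, hFG, hvG⟩ := h.exists_larger_face hF hn hv hvF hd
      have hlt' : pdim F < pdim G := hF.pdim_lt (IsExposed.subset hG) hFG
      obtain ⟨G', h1, h2, h3⟩ := ih _ (by omega) hG (hn.mono hFG.subset) hvG rfl
      exact ⟨G', h1, hFG.subset.trans h2, h3⟩
    · exact ⟨F, ⟨hF, by omega⟩, Set.Subset.rfl, hvF⟩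

theorem IsFacet.ne [FiniteDimensional ℝ E] (hF : IsFacet P F) : F ≠ P := by
  rintro rfl
  have := hF.2
  omega

theorem IsVertexArray.exists_facet_of_ne [FiniteDimensional ℝ E] (h : IsVertexArray P x)
    (hF : IsFace P F) (hn : F.Nonempty) (hne : F ≠ P) : ∃ G, IsFacet P G ∧ F ⊆ G := by
  have : ∃ v ∈ P, v ∉ F := by
    by_contra! hcon
    exact hne ((IsExposed.subset hF).antisymm hcon)
  obtain ⟨v, hv, hvF⟩ := this
  obtain ⟨G, h1, h2, -⟩ := h.exists_facet hF hn hv hvF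
  exact ⟨G, h1, h2⟩

/-- The intersection of a family of faces indexed by a finite set is a face. -/
theorem isFace_inter_of_finite {ι : Type*} (s : Finset ι) (f : ι → Set E)
    (hf : ∀ i ∈ s, IsFace P (f i)) : IsFace P {p ∈ P | ∀ i ∈ s, p ∈ f i} := by
  classical
  induction s using Finset.induction_on with
  | empty => simpa using IsFace.self P
  | insert a s ha ih =>
    have := IsExposed.inter (hf a (Finset.mem_insert_self _ _))
      (ih fun i hi => hf i (Finset.mem_insert_of_mem hi))
    have hsub : f a ⊆ P := IsExposed.subset (hf a (Finset.mem_insert_self _ _))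
    suffices he : {p ∈ P | ∀ i ∈ insert a s, p ∈ f i} = f a ∩ {p ∈ P | ∀ i ∈ s, p ∈ f i} by
      rw [he]; exact this
    ext p
    simp only [Finset.mem_insert, forall_eq_or_imp, Set.mem_ofPred_eq, Set.mem_inter_iff]
    constructor
    · rintro ⟨h1, h2, h3⟩
      exact ⟨h2, h1, h3⟩
    · rintro ⟨h1, h2, h3⟩
      exact ⟨hsub h1, h1, h3⟩

/-- A set of vertices that is an intersection of vertex sets of faces spans a face. -/
theorem IsVertexArray.isFace_hull (h : IsVertexArray P x) {A : Set (Fin (n + 1))}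
    (hA : ∀ i ∉ A, ∃ B : Set (Fin (n + 1)), IsFace P (convexHull ℝ (x '' B)) ∧ A ⊆ B ∧ i ∉ B) :
    IsFace P (convexHull ℝ (x '' A)) := by
  classical
  choose! B hB using hA
  have hf := isFace_inter_of_finite (P := P) (Finset.univ.filter (· ∉ A))
    (fun i => convexHull ℝ (x '' B i)) (by simpa using fun i hi => (hB i hi).1)
  rw [h.face_eq_hull hf] at hf
  suffices he : {i | x i ∈ {p ∈ P | ∀ k ∈ Finset.univ.filter (· ∉ A), p ∈
      convexHull ℝ (x '' B k)}} = A by rwa [he] at hf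
  ext i
  simp only [Finset.mem_filter, Finset.mem_univ, true_and, Set.mem_ofPred_eq, h.mem_hull_iff]
  exact ⟨fun hi => by
    by_contra hiA
    exact (hB i hiA).2.2 (hi.2 i hiA), fun hi => ⟨h.mem i, fun k hk => (hB k hk).2.1 hi⟩⟩

/-- The vertex array induced on a face. -/
theorem IsVertexArray.face (h : IsVertexArray P x) (hF : IsFace P F) {m : ℕ}
    (σ : Fin (m + 1) → Fin (n + 1)) (hσ : Function.Injective σ)
    (hr : ∀ i, i ∈ Set.range σ ↔ x i ∈ F) : IsVertexArray F (x ∘ σ) := by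
  have hFe : F = convexHull ℝ (Set.range (x ∘ σ)) := by
    rw [Set.range_comp]
    conv_lhs => rw [h.face_eq_hull hF]
    congr 2
    ext i
    exact (hr i).symm
  refine ⟨h.injective.comp hσ, Set.Subset.antisymm ?_ ?_, hFe⟩
  · intro v hv
    have h1 : v ∈ F.extremePoints ℝ := exposedPoints_subset_extremePoints
      (mem_exposedPoints_iff_exposed_singleton.2 hv)
    rw [hFe] at h1
    exact extremePoints_convexHull_subset h1
  · rintro _ ⟨i, rfl⟩
    exact IsExposed.mono (h.isFace_singleton (σ i)) (IsExposed.subset hF)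
      (Set.singleton_subset_iff.2 ((hr _).1 ⟨i, rfl⟩))

end

section

variable {E : Type*} [NormedAddCommGroup E] [NormedSpace ℝ E]
variable {d n : ℕ} {x : Fin (n + 1) → E} {P Q F G : Set E}

/-! ### Facets of braxtopes in terms of indices -/

/-- The indices of the vertices of `T_i`. -/
def indexT (d n i : ℕ) : Set (Fin (n + 1)) := {t | i ≤ (t : ℕ) ∧ (t : ℕ) < i + d}

/-- The indices of the vertices of `E_j`. By the convention `x_t = x_n` for `t ≥ n`, the vertex
`x_n` belongs to `E_n`. -/
def indexE (d n j : ℕ) : Set (Fin (n + 1)) :=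
  {t | (t : ℕ) = 0 ∨ j + 2 ≤ t + d ∧ t + 2 ≤ j + d ∧ ((t : ℕ) ≠ j ∨ (t : ℕ) = n)}

theorem mem_indexT {i : ℕ} {t : Fin (n + 1)} : t ∈ indexT d n i ↔ i ≤ (t : ℕ) ∧ (t : ℕ) < i + d :=
  Iff.rfl

theorem mem_indexE {j : ℕ} {t : Fin (n + 1)} : t ∈ indexE d n j ↔
    (t : ℕ) = 0 ∨ j + 2 ≤ t + d ∧ t + 2 ≤ j + d ∧ ((t : ℕ) ≠ j ∨ (t : ℕ) = n) :=
  Iff.rfl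

/-- The index sets of the facets of a `d`-braxtope with `n + 1` vertices. -/
def IsFacetIndex (d n : ℕ) (B : Set (Fin (n + 1))) : Prop :=
  (∃ i, i + d ≤ n + 1 ∧ B = indexT d n i) ∨ ∃ j, 2 ≤ j ∧ j ≤ n ∧ B = indexE d n j

theorem vtx_eq_of_le {X : Type*} (x : Fin (n + 1) → X) {t : ℤ} {s : Fin (n + 1)}
    (h : (s : ℕ) = min t.toNat n) : vtx x t = x s := by
  rw [vtx]
  congr 1
  exact Fin.ext h.symm

theorem facetT_eq (x : Fin (n + 1) → E) {i : ℕ} (h : i + d ≤ n + 1) :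
    facetT d x i = convexHull ℝ (x '' indexT d n i) := by
  rw [facetT]
  congr 1
  ext p
  constructor
  · rintro ⟨t, ⟨h1, h2⟩, rfl⟩
    exact ⟨⟨min t.toNat n, by omega⟩, ⟨by simp; omega, by simp; omega⟩, rfl⟩
  · rintro ⟨s, ⟨h1, h2⟩, rfl⟩
    exact ⟨(s : ℕ), ⟨by omega, by omega⟩, vtx_eq_of_le x (by have := s.2; omega)⟩

theorem facetE_eq (x : Fin (n + 1) → E) (hd : 3 ≤ d) {j : ℕ} (h2 : 2 ≤ j) (hj : j ≤ n) :
    facetE d x j = convexHull ℝ (x '' indexE d n j) := by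
  rw [facetE]
  congr 1
  ext p
  constructor
  · rintro (rfl | ⟨t, ⟨h1, h2, h3⟩, rfl⟩)
    · exact ⟨0, Or.inl rfl, rfl⟩
    · refine ⟨⟨min t.toNat n, by omega⟩, ?_, rfl⟩
      rw [mem_indexE]
      simp only
      omega
  · rintro ⟨s, h1 | ⟨h1, h3, h4⟩, rfl⟩
    · left
      congr 1
      exact Fin.ext h1
    · right
      by_cases hs : (s : ℕ) = j
      -- The vertex `x_n` of `E_n` is `x_{n + 1}`.
      · exact ⟨(j : ℤ) + 1, ⟨by omega, by omega, by omega⟩, vtx_eq_of_le x (by omega)⟩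
      · exact ⟨(s : ℕ), ⟨by omega, by omega, by omega⟩,
          vtx_eq_of_le x (by have := s.2; omega)⟩

theorem facets_eq_iff (hd : 3 ≤ d) :
    {F | IsFacet P F} =
        {F | (∃ i : ℤ, 0 ≤ i ∧ i ≤ (n : ℤ) - d + 1 ∧ F = facetT d x i) ∨
          (∃ j : ℤ, 2 ≤ j ∧ j ≤ (n : ℤ) ∧ F = facetE d x j)} ↔
      ∀ F, IsFacet P F ↔ ∃ B, IsFacetIndex d n B ∧ F = convexHull ℝ (x '' B) := by
  rw [Set.ext_iff]
  refine forall_congr' fun F => ?_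
  simp only [Set.mem_ofPred_eq]
  have : ((∃ i : ℤ, 0 ≤ i ∧ i ≤ (n : ℤ) - d + 1 ∧ F = facetT d x i) ∨
          (∃ j : ℤ, 2 ≤ j ∧ j ≤ (n : ℤ) ∧ F = facetE d x j)) ↔
      ∃ B, IsFacetIndex d n B ∧ F = convexHull ℝ (x '' B) := by
    constructor
    · rintro (⟨i, h0, h1, rfl⟩ | ⟨j, h0, h1, rfl⟩)
      · lift i to ℕ using h0
        exact ⟨_, Or.inl ⟨i, by omega, rfl⟩, facetT_eq x (by omega)⟩
      · lift j to ℕ using by omega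
        exact ⟨_, Or.inr ⟨j, by omega, by omega, rfl⟩, facetE_eq x hd (by omega) (by omega)⟩
    · rintro ⟨B, ⟨i, hi, rfl⟩ | ⟨j, h2, hj, rfl⟩, rfl⟩
      · exact Or.inl ⟨i, by omega, by omega, (facetT_eq x hi).symm⟩
      · exact Or.inr ⟨j, by omega, by omega, (facetE_eq x hd h2 hj).symm⟩
  rw [this]

theorem IsBraxtope.isFacet_iff (hQ : IsBraxtope d x Q) (hd : 3 ≤ d) :
    IsFacet Q F ↔ ∃ B, IsFacetIndex d n B ∧ F = convexHull ℝ (x '' B) :=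
  (facets_eq_iff hd).1 (hQ.2.2.2 hd).2 F

theorem isBraxtope_of_isFacet_iff (h : IsVertexArray P x) (hP : pdim P = d) (hd : 3 ≤ d)
    (hn : d ≤ n) (hF : ∀ F, IsFacet P F ↔ ∃ B, IsFacetIndex d n B ∧ F = convexHull ℝ (x '' B)) :
    IsBraxtope d x P :=
  ⟨h, hP, fun h => by omega, fun _ => ⟨hn, (facets_eq_iff hd).2 hF⟩⟩

theorem IsBraxtope.isFacet (hQ : IsBraxtope d x Q) (hd : 3 ≤ d) {B : Set (Fin (n + 1))}
    (hB : IsFacetIndex d n B) : IsFacet Q (convexHull ℝ (x '' B)) :=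
  (hQ.isFacet_iff hd).2 ⟨B, hB, rfl⟩

theorem IsBraxtope.isFace (hQ : IsBraxtope d x Q) (hd : 3 ≤ d) {B : Set (Fin (n + 1))}
    (hB : IsFacetIndex d n B) : IsFace Q (convexHull ℝ (x '' B)) :=
  (hQ.isFacet hd hB).1

/-- A vertex outside a nonempty face is separated from it by a facet of the braxtope. -/
theorem IsBraxtope.exists_facetIndex [FiniteDimensional ℝ E] (hQ : IsBraxtope d x Q) (hd : 3 ≤ d)
    (hF : IsFace Q F) (hn : F.Nonempty) {i : Fin (n + 1)} (hi : x i ∉ F) :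
    ∃ B, IsFacetIndex d n B ∧ (∀ t, x t ∈ F → t ∈ B) ∧ i ∉ B := by
  obtain ⟨G, hG, hFG, hiG⟩ := hQ.1.exists_facet hF hn (hQ.1.mem i) hi
  obtain ⟨B, hB, rfl⟩ := (hQ.isFacet_iff hd).1 hG
  exact ⟨B, hB, fun t ht => hQ.1.mem_hull_iff.1 (hFG ht), fun h => hiG (hQ.1.mem_hull_iff.2 h)⟩

theorem IsBraxtope.isFace_hull (hQ : IsBraxtope d x Q) (hd : 3 ≤ d) {A : Set (Fin (n + 1))}
    (hA : ∀ i ∉ A, ∃ B, IsFacetIndex d n B ∧ A ⊆ B ∧ i ∉ B) :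
    IsFace Q (convexHull ℝ (x '' A)) := by
  refine hQ.1.isFace_hull fun i hi => ?_
  obtain ⟨B, hB, h⟩ := hA i hi
  exact ⟨B, hQ.isFace hd hB, h⟩

/-! ### Dimension and affine independence -/

theorem pdim_hull_of_affineIndependent {A : Finset (Fin (n + 1))}
    (hA : AffineIndependent ℝ fun i : A => x i) :
    pdim (convexHull ℝ (x '' A)) = (A.card : ℤ) - 1 := by
  rw [pdim_convexHull]
  rcases A.eq_empty_or_nonempty with rfl | hne
  · simp [pdim_empty]
  have hr : Set.range (fun i : A => x i) = x '' (A : Set (Fin (n + 1))) := by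
    ext p; simp
  rw [pdim_of_nonempty (by simpa using hne), ← hr, hA.finrank_vectorSpan (n := A.card - 1)]
  · have := hne.card_pos
    omega
  · have := hne.card_pos
    simp only [Fintype.card_coe]
    omega

theorem affineIndependent_of_pdim {A : Finset (Fin (n + 1))}
    (h : (A.card : ℤ) - 1 ≤ pdim (x '' (A : Set (Fin (n + 1))))) :
    AffineIndependent ℝ fun i : A => x i := by
  rcases A.eq_empty_or_nonempty with rfl | hne
  · exact affineIndependent_of_subsingleton ℝ _
  have hr : Set.range (fun i : A => x i) = x '' (A : Set (Fin (n + 1))) := by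
    ext p; simp
  have hpos := hne.card_pos
  rw [affineIndependent_iff_le_finrank_vectorSpan ℝ _ (n := A.card - 1)
    (by simp only [Fintype.card_coe]; omega), hr]
  rw [pdim_of_nonempty (by simpa using hne)] at h
  omega

theorem affineIndependent_mono {A B : Finset (Fin (n + 1))} (hAB : A ⊆ B)
    (hB : AffineIndependent ℝ fun i : B => x i) : AffineIndependent ℝ fun i : A => x i :=
  hB.comp_embedding (⟨fun i => ⟨i, hAB i.2⟩, fun _ _ h =>
    Subtype.ext (congrArg (fun z : B => (z : Fin (n + 1))) h)⟩ : A ↪ B)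

end

section

/-! ### Combinatorics of the face lattice -/

/-- `InE d n j t` says that the vertex `x_t` belongs to the facet `E_j`. -/
def InE (d n j t : ℕ) : Prop := t = 0 ∨ j + 2 ≤ t + d ∧ t + 2 ≤ j + d ∧ (t ≠ j ∨ t = n)

/-- A set of indices is closed if it is an intersection of index sets of facets of a
`d`-braxtope with `n + 1` vertices. -/
def IsClosedIndex (d n : ℕ) (A : Set ℕ) : Prop :=
  (∀ t ∈ A, t ≤ n) ∧ ∀ i ≤ n, i ∉ A →
    (∃ k, k + d ≤ n + 1 ∧ (∀ t ∈ A, k ≤ t ∧ t < k + d) ∧ ¬ (k ≤ i ∧ i < k + d)) ∨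
    ∃ j, 2 ≤ j ∧ j ≤ n ∧ (∀ t ∈ A, InE d n j t) ∧ ¬ InE d n j i

/-- The part of `A` that lies in `{0} ∪ [a, a + d - 1]`, where `a` is the least nonzero element
of `A`. -/
def window (d : ℕ) (A : Set ℕ) : Set ℕ := {t ∈ A | t = 0 ∨ ∀ s ∈ A, s ≠ 0 → t < s + d}

/-- The sets that arise as windows of closed sets. -/
def IsAdmissible (d n : ℕ) (W : Set ℕ) : Prop :=
  (∀ t ∈ W, t ≤ n) ∧ (∀ s ∈ W, ∀ t ∈ W, s ≠ 0 → t < s + d) ∧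
    (0 ∈ W → ∀ a ∈ W, 2 ≤ a → a + d ≤ n + 1 → (∀ t ∈ W, t ≠ 0 → a ≤ t) → a + d - 2 ∉ W)

variable {d n : ℕ} {A W : Set ℕ}

theorem window_subset : window d A ⊆ A := fun _ h => h.1

theorem window_eq_self (h : ∀ s ∈ A, ∀ t ∈ A, s ≠ 0 → t < s + d) : window d A = A :=
  window_subset.antisymm fun t ht => ⟨ht, Or.inr fun s hs => h s hs t ht⟩

theorem exists_least_ne_zero (h : ∃ a ∈ A, a ≠ 0) : ∃ a ∈ A, a ≠ 0 ∧ ∀ t ∈ A, t ≠ 0 → a ≤ t := by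
  classical
  have h' : ∃ a, a ∈ A ∧ a ≠ 0 := h
  exact ⟨Nat.find h', (Nat.find_spec h').1, (Nat.find_spec h').2,
    fun t ht ht0 => Nat.find_min' h' ⟨ht, ht0⟩⟩

/-- Either a closed set fits into a window, or it contains `0`, `a` and `a + d - 1` for its least
nonzero element `a` and every `j` in between that it misses is missed because it lies in `E_j`. -/
theorem IsClosedIndex.cases (hd : 3 ≤ d) (hA : IsClosedIndex d n A) :
    (∀ s ∈ A, ∀ t ∈ A, s ≠ 0 → t < s + d) ∨
    ∃ a, 1 ≤ a ∧ a + d ≤ n + 1 ∧ 0 ∈ A ∧ a ∈ A ∧ a + d - 1 ∈ A ∧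
      (∀ s ∈ A, s ≠ 0 → a ≤ s) ∧
      ∀ j, a < j → j < a + d - 1 → j ∉ A → ∀ t ∈ A, InE d n j t := by
  by_cases h0 : 0 ∈ A
  swap
  · left
    rcases hA.2 0 (Nat.zero_le _) h0 with ⟨k, hk, hs, hn⟩ | ⟨j, -, -, -, hn⟩
    · intro s hs' t ht _
      have := hs s hs'
      have := hs t ht
      omega
    · exact absurd (Or.inl rfl) hn
  by_cases h1 : ∃ a ∈ A, a ≠ 0
  swap
  · push Not at h1
    exact Or.inl fun s hs t ht hs0 => absurd (h1 s hs) hs0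
  obtain ⟨a, ha, ha0, hmin⟩ := exists_least_ne_zero h1
  by_cases had : a + d ≤ n + 1
  swap
  · left
    intro s hs t ht hs0
    have := hmin s hs hs0
    have := hA.1 t ht
    omega
  by_cases hb : a + d - 1 ∈ A
  · right
    refine ⟨a, by omega, had, h0, ha, hb, hmin, fun j haj hja hj => ?_⟩
    rcases hA.2 j (by omega) hj with ⟨k, hk, hs, hn⟩ | ⟨j', h2, hj', hs, hn⟩
    · have := hs _ h0
      have := hs _ hb
      omega
    · have e1 := hs _ ha
      have e2 := hs _ hb
      have : j' = j := by unfold InE at *; omega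
      exact this ▸ hs
  · left
    -- A facet through `0` and `a` that misses `a + d - 1` has no larger index either.
    rcases hA.2 _ (by omega) hb with ⟨k, hk, hs, hn⟩ | ⟨j', h2, hj', hs, hn⟩
    · have := hs _ h0
      intro s hs' t ht hs0
      have := hs t ht
      have := hmin s hs' hs0
      omega
    · intro s hs' t ht hs0
      have e1 := hs _ ha
      have e2 := hs _ ht
      have := hmin s hs' hs0
      unfold InE at *
      omega

theorem IsClosedIndex.isAdmissible_window (hd : 3 ≤ d) (hA : IsClosedIndex d n A) :
    IsAdmissible d n (window d A) := by
  refine ⟨fun t ht => hA.1 t ht.1, fun s hs t ht hs0 => ?_, fun h0 a ha ha2 had hmin hb => ?_⟩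
  · rcases ht.2 with rfl | h
    · omega
    · exact h s hs.1 hs0
  have hmin' : ∀ t ∈ A, t ≠ 0 → a ≤ t := by
    by_contra! hcon
    obtain ⟨t, ht, ht0, hta⟩ := hcon
    have hw : t ∈ window d A := by
      refine ⟨ht, Or.inr fun s hs hs0 => ?_⟩
      rcases ha.2 with h | h
      · omega
      · have := h s hs hs0
        omega
    have := hmin t hw ht0
    omega
  have ha1 : a - 1 ∉ A := fun h => by
    have := hmin' _ h (by omega)
    omega
  -- Every facet that contains `0` and `a` but not `a - 1` misses `a + d - 2`.
  rcases hA.2 (a - 1) (by omega) ha1 with ⟨k, hk, hs, hn⟩ | ⟨j', h2, hj', hs, hn⟩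
  · have := hs _ h0.1
    have := hs _ ha.1
    omega
  · have e1 := hs _ ha.1
    have e2 := hs _ hb.1
    unfold InE at *
    omega

/-- An admissible set that does not contain all of `0`, `a`, `a + d - 1` for its least nonzero
element `a` is closed. -/
theorem IsAdmissible.isClosedIndex (hd : 3 ≤ d) (hn : d ≤ n) (hW : IsAdmissible d n W)
    (h : 0 ∈ W → ∀ a ∈ W, a ≠ 0 → a + d ≤ n + 1 → (∀ t ∈ W, t ≠ 0 → a ≤ t) → a + d - 1 ∉ W) :
    IsClosedIndex d n W := by
  obtain ⟨hW1, hW2, hW3⟩ := hW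
  refine ⟨hW1, fun i hi hiW => ?_⟩
  by_cases h1 : ∃ a ∈ W, a ≠ 0
  swap
  · push Not at h1
    by_cases hi0 : i = 0
    · exact Or.inl ⟨n + 1 - d, by omega, fun t ht => absurd (h1 t ht ▸ ht) (hi0 ▸ hiW), by omega⟩
    by_cases hid : i < d
    · by_cases hi1 : i = 1
      · exact Or.inr ⟨n, by omega, le_rfl, fun t ht => Or.inl (h1 t ht), by unfold InE; omega⟩
      · exact Or.inr ⟨i, by omega, by omega, fun t ht => Or.inl (h1 t ht), by unfold InE; omega⟩
    · exact Or.inl ⟨0, by omega, fun t ht => by rw [h1 t ht]; omega, by omega⟩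
  obtain ⟨a, ha, ha0, hmin⟩ := exists_least_ne_zero h1
  have hle : ∀ t ∈ W, t ≤ n ∧ t < a + d ∧ (t = 0 ∨ a ≤ t) := fun t ht =>
    ⟨hW1 t ht, hW2 a ha t ht ha0, by
      by_cases ht0 : t = 0
      · exact Or.inl ht0
      · exact Or.inr (hmin t ht ht0)⟩
  by_cases h0 : 0 ∈ W
  swap
  · have hle' : ∀ t ∈ W, t ≤ n ∧ t < a + d ∧ a ≤ t ∧ t ≠ i := fun t ht => by
      have h2 := hle t ht
      have h3 : t ≠ 0 := fun e => h0 (e ▸ ht)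
      have h4 : t ≠ i := fun e => hiW (e ▸ ht)
      omega
    -- The set lies in the simplex `T_k`, and every subset of that simplex is closed.
    obtain ⟨k, hk⟩ : ∃ k, k = min a (n + 1 - d) := ⟨_, rfl⟩
    by_cases hik : k ≤ i ∧ i < k + d
    swap
    · exact Or.inl ⟨k, by omega, fun t ht => by have := hle' t ht; omega, hik⟩
    by_cases e1 : i = k
    · by_cases e2 : k + d ≤ n
      · exact Or.inl ⟨k + 1, by omega, fun t ht => by have := hle' t ht; omega, by omega⟩
      · exact Or.inr ⟨n, by omega, le_rfl, fun t ht => by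
          have := hle' t ht; unfold InE; omega, by unfold InE; omega⟩
    by_cases e3 : i = k + d - 1
    · exact Or.inl ⟨k - 1, by omega, fun t ht => by have := hle' t ht; omega, by omega⟩
    · exact Or.inr ⟨i, by omega, by omega, fun t ht => by
        have := hle' t ht; unfold InE; omega, by unfold InE; omega⟩
  have hle' : ∀ t ∈ W, t ≤ n ∧ t < a + d ∧ (t = 0 ∨ a ≤ t) ∧ t ≠ i := fun t ht => by
    have h2 := hle t ht
    have h4 : t ≠ i := fun e => hiW (e ▸ ht)
    omega
  have hi0 : i ≠ 0 := fun e => hiW (e ▸ h0)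
  by_cases had : a + d ≤ n + 1
  · have hb : ∀ t ∈ W, t ≠ a + d - 1 := fun t ht e => h h0 a ha ha0 had hmin (e ▸ ht)
    -- For `a = 1` the set lies in the simplex `T_0`.
    by_cases ha1 : a = 1
    · by_cases hid : i < d
      · by_cases hi1 : i = 1
        · exact absurd (hi1 ▸ ha1 ▸ ha) hiW
        exact Or.inr ⟨i, by omega, by omega, fun t ht => by
          have := hle' t ht; have := hb t ht; unfold InE; omega, by unfold InE; omega⟩
      · exact Or.inl ⟨0, by omega, fun t ht => by
          have := hle' t ht; have := hb t ht; omega, by omega⟩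
    have hc : ∀ t ∈ W, t ≠ a + d - 2 := fun t ht e =>
      hW3 h0 a ha (by omega) had hmin (e ▸ ht)
    have hai : i ≠ a := fun e => hiW (e ▸ ha)
    have hle'' : ∀ t ∈ W, t ≤ n ∧ t + 2 < a + d ∧ (t = 0 ∨ a ≤ t) ∧ t ≠ i := fun t ht => by
      have := hle' t ht
      have := hb t ht
      have := hc t ht
      omega
    -- The set lies in `[a, a + d - 3]` apart from `0`: indices below and above are cut off by
    -- `E_{a + d - 2}` and `E_{a - 1}` (`T_0` if `a = 2`), and an index `i` in between by `E_i`.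
    by_cases e1 : i < a
    · exact Or.inr ⟨a + d - 2, by omega, by omega, fun t ht => by
        have := hle'' t ht; unfold InE; omega, by unfold InE; omega⟩
    by_cases e2 : a + d ≤ i + 2
    · by_cases ha2 : a = 2
      · exact Or.inl ⟨0, by omega, fun t ht => by have := hle'' t ht; omega, by omega⟩
      · exact Or.inr ⟨a - 1, by omega, by omega, fun t ht => by
          have := hle'' t ht; unfold InE; omega, by unfold InE; omega⟩
    · exact Or.inr ⟨i, by omega, by omega, fun t ht => by
        have := hle'' t ht; unfold InE; omega, by unfold InE; omega⟩
  -- Otherwise the set lies in the simplex `E_n`.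
  · by_cases e1 : i + d ≤ n + 1
    · exact Or.inr ⟨n, by omega, le_rfl, fun t ht => by
        have := hle' t ht; unfold InE; omega, by unfold InE; omega⟩
    by_cases e2 : i = n
    · by_cases e3 : n = d
      · exact Or.inl ⟨0, by omega, fun t ht => by have := hle' t ht; omega, by omega⟩
      · exact Or.inr ⟨n + 1 - d, by omega, by omega, fun t ht => by
          have := hle' t ht; unfold InE; omega, by unfold InE; omega⟩
    · exact Or.inr ⟨i, by omega, by omega, fun t ht => by
        have := hle' t ht; unfold InE; omega, by unfold InE; omega⟩

theorem IsAdmissible.exists_isClosedIndex (hd : 3 ≤ d) (hn : d ≤ n) (hW : IsAdmissible d n W) :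
    ∃ A, IsClosedIndex d n A ∧ window d A = W := by
  by_cases h : 0 ∈ W → ∀ a ∈ W, a ≠ 0 → a + d ≤ n + 1 → (∀ t ∈ W, t ≠ 0 → a ≤ t) →
      a + d - 1 ∉ W
  · exact ⟨W, hW.isClosedIndex hd hn h, window_eq_self hW.2.1⟩
  push Not at h
  obtain ⟨h0, a, ha, ha0, had, hmin, hb⟩ := h
  obtain ⟨hW1, hW2, hW3⟩ := hW
  -- The closure is the intersection of the `E_j` over the `j` between `a` and `a + d - 1` that the
  -- set skips.
  have hA0 : ∀ j, InE d n j 0 := fun j => Or.inl rfl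
  have hle : ∀ t ∈ W, t < a + d ∧ (t = 0 ∨ a ≤ t) := fun t ht =>
    ⟨hW2 a ha t ht ha0, by
      by_cases ht0 : t = 0
      · exact Or.inl ht0
      · exact Or.inr (hmin t ht ht0)⟩
  have hlow : ∀ t, t ≠ 0 → t < a → ∃ j, a < j ∧ j < a + d - 1 ∧ j ∉ W ∧ ¬ InE d n j t := by
    intro t ht0 hta
    exact ⟨a + d - 2, by omega, by omega, hW3 h0 a ha (by omega) had hmin, by unfold InE; omega⟩
  have hmem : ∀ t, t < a + d → (t ∈ W ↔
      t ≤ n ∧ ∀ j, a < j → j < a + d - 1 → j ∉ W → InE d n j t) := by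
    intro t ht
    constructor
    · intro htW
      refine ⟨hW1 t htW, fun j h1 h2 hj => ?_⟩
      have h3 : t ≠ j := fun e => hj (e ▸ htW)
      have := hle t htW
      unfold InE
      omega
    · rintro ⟨htn, hall⟩
      by_contra htW
      have ht0 : t ≠ 0 := fun e => htW (e ▸ h0)
      have hta : t ≠ a := fun e => htW (e ▸ ha)
      have htb : t ≠ a + d - 1 := fun e => htW (e ▸ hb)
      by_cases h1 : t < a
      · obtain ⟨j, e1, e2, e3, e4⟩ := hlow t ht0 h1
        exact e4 (hall j e1 e2 e3)
      · have := hall t (by omega) (by omega) htW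
        unfold InE at this
        omega
  refine ⟨{t | t ≤ n ∧ ∀ j, a < j → j < a + d - 1 → j ∉ W → InE d n j t},
    ⟨fun t ht => ht.1, fun i hi hiA => ?_⟩, ?_⟩
  · have : ∃ j, a < j ∧ j < a + d - 1 ∧ j ∉ W ∧ ¬ InE d n j i := by
      by_contra! hcon
      exact hiA ⟨hi, hcon⟩
    obtain ⟨j, h1, h2, h3, h4⟩ := this
    exact Or.inr ⟨j, by omega, by omega, fun t ht => ht.2 j h1 h2 h3, h4⟩
  · ext t
    constructor
    · rintro ⟨ht, hw⟩
      refine (hmem t ?_).2 ht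
      rcases hw with rfl | hw
      · omega
      · exact hw a ((hmem a (by omega)).1 ha) ha0
    · intro ht
      have := (hle t ht).1
      refine ⟨(hmem t this).1 ht, Or.inr fun s hs hs0 => ?_⟩
      by_contra hlt
      by_cases hsa : s < a
      · obtain ⟨j, e1, e2, e3, e4⟩ := hlow s hs0 hsa
        exact e4 (hs.2 j e1 e2 e3)
      · omega

end

section

variable {E : Type*} [NormedAddCommGroup E] [NormedSpace ℝ E]
variable {d n : ℕ} {x : Fin (n + 1) → E} {P Q F G : Set E}

/-! ### The face lattice of a braxtope -/

/-- The indices of the vertices in `F`, as natural numbers. -/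
def indexSet {X : Type*} (x : Fin (n + 1) → X) (F : Set X) : Set ℕ :=
  {t | ∃ i : Fin (n + 1), (i : ℕ) = t ∧ x i ∈ F}

theorem val_mem_indexSet {X : Type*} {x : Fin (n + 1) → X} {F : Set X} {i : Fin (n + 1)} :
    (i : ℕ) ∈ indexSet x F ↔ x i ∈ F :=
  ⟨fun ⟨_, h, hj⟩ => Fin.ext h ▸ hj, fun h => ⟨i, rfl, h⟩⟩

theorem mem_indexSet_hull (h : IsVertexArray P x) {A : Set ℕ} (hA : ∀ t ∈ A, t ≤ n) :
    indexSet x (convexHull ℝ (x '' {i | (i : ℕ) ∈ A})) = A := by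
  ext t
  constructor
  · rintro ⟨i, rfl, hi⟩
    exact h.mem_hull_iff.1 hi
  · intro ht
    exact ⟨⟨t, Nat.lt_succ_of_le (hA t ht)⟩, rfl, h.mem_hull_iff.2 ht⟩

theorem IsBraxtope.isClosedIndex [FiniteDimensional ℝ E] (hQ : IsBraxtope d x Q) (hd : 3 ≤ d)
    (hF : IsFace Q F) (hn : F.Nonempty) : IsClosedIndex d n (indexSet x F) := by
  refine ⟨?_, fun i hi hiF => ?_⟩
  · rintro _ ⟨i, rfl, -⟩
    exact Nat.le_of_lt_succ i.2
  · obtain ⟨B, hB, hs, hiB⟩ := hQ.exists_facetIndex hd hF hn (i := ⟨i, Nat.lt_succ_of_le hi⟩)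
      (fun h => hiF (val_mem_indexSet.2 h))
    rcases hB with ⟨k, hk, rfl⟩ | ⟨j, h2, hj, rfl⟩
    · refine Or.inl ⟨k, hk, ?_, hiB⟩
      rintro _ ⟨t, rfl, ht⟩
      exact hs t ht
    · refine Or.inr ⟨j, h2, hj, ?_, hiB⟩
      rintro _ ⟨t, rfl, ht⟩
      exact hs t ht

theorem IsBraxtope.isFace_of_isClosedIndex (hQ : IsBraxtope d x Q) (hd : 3 ≤ d) {A : Set ℕ}
    (hA : IsClosedIndex d n A) : IsFace Q (convexHull ℝ (x '' {i | (i : ℕ) ∈ A})) := by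
  refine hQ.isFace_hull hd fun i hi => ?_
  rcases hA.2 i (Nat.le_of_lt_succ i.2) hi with ⟨k, hk, hs, hn⟩ | ⟨j, h2, hj, hs, hn⟩
  · exact ⟨_, Or.inl ⟨k, hk, rfl⟩, fun t ht => hs _ ht, hn⟩
  · exact ⟨_, Or.inr ⟨j, h2, hj, rfl⟩, fun t ht => hs _ ht, hn⟩

/-- The index set of the affine basis formed by `x_0` and the vertices of `T_a`. -/
def basisIndex (d n a : ℕ) : Finset (Fin (n + 1)) :=
  Finset.univ.filter fun t => (t : ℕ) = 0 ∨ a ≤ (t : ℕ) ∧ (t : ℕ) < a + d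

theorem mem_basisIndex {a : ℕ} {t : Fin (n + 1)} :
    t ∈ basisIndex d n a ↔ (t : ℕ) = 0 ∨ a ≤ (t : ℕ) ∧ (t : ℕ) < a + d := by
  simp [basisIndex]

theorem card_basisIndex_le (d n a : ℕ) : (basisIndex d n a).card ≤ d + 1 := by
  rw [← Finset.card_map Fin.valEmbedding]
  have hsub : (basisIndex d n a).map Fin.valEmbedding ⊆ insert 0 (Finset.Ico a (a + d)) := by
    intro t ht
    obtain ⟨i, hi, rfl⟩ := Finset.mem_map.1 ht
    have := mem_basisIndex.1 hi
    simp only [Fin.valEmbedding_apply, Finset.mem_insert, Finset.mem_Ico]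
    exact this
  refine (Finset.card_le_card hsub).trans ((Finset.card_insert_le _ _).trans ?_)
  simp

theorem IsBraxtope.pdim_basis [FiniteDimensional ℝ E] (hQ : IsBraxtope d x Q) (hd : 3 ≤ d)
    {a : ℕ} (ha : 1 ≤ a) (had : a + d ≤ n + 1) : pdim (x '' (basisIndex d n a : Set _)) = d := by
  have hT : IsFacetIndex d n (indexT d n a) := Or.inl ⟨a, had, rfl⟩
  have h0 : x 0 ∉ affineSpan ℝ (x '' indexT d n a) := by
    rw [← affineSpan_convexHull]
    intro h
    have := (hQ.isFace hd hT).mem_of_mem_affineSpan (hQ.1.mem 0) h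
    have := mem_indexT.1 (hQ.1.mem_hull_iff.1 this)
    simp at this
    omega
  have h1 := pdim_insert_of_notMem h0
  rw [← pdim_convexHull (x '' _), (hQ.isFacet hd hT).2, hQ.2.1] at h1
  have h2 : x '' (basisIndex d n a : Set (Fin (n + 1))) = insert (x 0) (x '' indexT d n a) := by
    rw [← Set.image_insert_eq]
    congr 1
    ext t
    simp only [Finset.mem_coe, mem_basisIndex, Set.mem_insert_iff, mem_indexT, Fin.ext_iff,
      Fin.val_zero]
  rw [h2, h1]
  ring

theorem IsBraxtope.affineIndependent_basis [FiniteDimensional ℝ E] (hQ : IsBraxtope d x Q)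
    (hd : 3 ≤ d) {a : ℕ} (ha : 1 ≤ a) (had : a + d ≤ n + 1) :
    AffineIndependent ℝ fun i : basisIndex d n a => x i := by
  refine affineIndependent_of_pdim ?_
  have := card_basisIndex_le d n a
  rw [hQ.pdim_basis hd ha had]
  omega

/-- Vertices whose nonzero indices lie within distance less than `d` are affinely independent. -/
theorem IsBraxtope.affineIndependent [FiniteDimensional ℝ E] (hQ : IsBraxtope d x Q)
    (hd : 3 ≤ d) {W : Finset (Fin (n + 1))}
    (hW : ∀ s ∈ W, ∀ t ∈ W, (s : ℕ) ≠ 0 → (t : ℕ) < s + d) :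
    AffineIndependent ℝ fun i : W => x i := by
  have hn := (hQ.2.2.2 hd).1
  by_cases h1 : ∃ a ∈ W, (a : ℕ) ≠ 0
  · obtain ⟨a, haW, hmin⟩ := Finset.exists_min_image (W.filter fun a : Fin (n + 1) => (a : ℕ) ≠ 0)
      (fun a => (a : ℕ)) (by
        obtain ⟨a, ha, h⟩ := h1
        exact ⟨a, Finset.mem_filter.2 ⟨ha, h⟩⟩)
    rw [Finset.mem_filter] at haW
    refine affineIndependent_mono (fun t ht => ?_)
      (hQ.affineIndependent_basis hd (a := min a (n + 1 - d)) (by omega) (by omega))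
    rw [mem_basisIndex]
    have h2 := hW a haW.1 t ht haW.2
    by_cases ht0 : (t : ℕ) = 0
    · exact Or.inl ht0
    · have := hmin t (Finset.mem_filter.2 ⟨ht, ht0⟩)
      have := t.2
      omega
  · push Not at h1
    refine affineIndependent_mono (fun t ht => ?_)
      (hQ.affineIndependent_basis hd (a := 1) le_rfl (by omega))
    exact mem_basisIndex.2 (Or.inl (h1 t ht))

theorem mem_affineSpan_of_insert {S : Set E} {v p : E} (hS : S.Nonempty) (l : E →L[ℝ] ℝ) {M : ℝ}
    (hl : ∀ q ∈ S, l q = M) (hv : l v ≠ M) (hp : l p = M)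
    (h : p ∈ affineSpan ℝ (insert v S)) : p ∈ affineSpan ℝ S := by
  obtain ⟨q, hq⟩ := hS
  have hq' := subset_affineSpan ℝ S hq
  rw [← affineSpan_insert_affineSpan, AffineSubspace.mem_affineSpan_insert_iff hq'] at h
  obtain ⟨r, p₀, hp₀, rfl⟩ := h
  have h1 := apply_eq_of_mem_affineSpan l hl hp₀
  have h2 : r * (l v - M) = 0 := by
    simpa [h1, hl q hq] using hp
  rcases mul_eq_zero.1 h2 with h3 | h3
  · simpa [h3] using hp₀
  · exact absurd (sub_eq_zero.1 h3) hv

/-- A face is contained in the affine span of the vertices in its window. -/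
theorem IsBraxtope.face_subset_affineSpan [FiniteDimensional ℝ E] (hQ : IsBraxtope d x Q)
    (hd : 3 ≤ d) (hF : IsFace Q F) (hn : F.Nonempty) :
    F ⊆ affineSpan ℝ (x '' {i | (i : ℕ) ∈ window d (indexSet x F)}) := by
  classical
  conv_lhs => rw [hQ.1.face_eq_hull hF]
  refine convexHull_min ?_ (AffineSubspace.convex _)
  rintro _ ⟨t, ht, rfl⟩
  rcases (hQ.isClosedIndex hd hF hn).cases hd with h | ⟨a, ha, had, h0, haF, hbF, hmin, hE⟩
  · refine subset_affineSpan ℝ _ ⟨t, ?_, rfl⟩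
    change (t : ℕ) ∈ window d _
    rw [window_eq_self h]
    exact val_mem_indexSet.2 ht
  have hfull : x t ∈ affineSpan ℝ (x '' (basisIndex d n a : Set _)) := by
    have hsub : x '' (basisIndex d n a : Set _) ⊆ Q := by
      rintro _ ⟨i, -, rfl⟩
      exact hQ.1.mem i
    have hne : (x '' (basisIndex d n a : Set _)).Nonempty :=
      ⟨x 0, 0, Finset.mem_coe.2 (mem_basisIndex.2 (Or.inl rfl)), rfl⟩
    have hdim := hQ.pdim_basis hd ha had
    rw [← hQ.2.1, pdim_of_nonempty hne, pdim_of_nonempty (hne.mono hsub)] at hdim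
    have hv := Submodule.eq_of_le_of_finrank_eq (vectorSpan_mono ℝ hsub) (by exact_mod_cast hdim)
    have : affineSpan ℝ (x '' (basisIndex d n a : Set _)) = affineSpan ℝ Q :=
      AffineSubspace.eq_of_direction_eq_of_nonempty_of_le
        (by rw [direction_affineSpan, direction_affineSpan, hv])
        ((affineSpan_nonempty ℝ).2 hne) (affineSpan_mono ℝ hsub)
    rw [this]
    exact subset_affineSpan ℝ _ (hQ.1.mem t)
  -- The functional exposing `E_j` is constant on the affine basis except at `x_j`, so the missing
  -- points `x_j` can be removed from the basis one at a time.
  have hJ : ∀ J : Finset (Fin (n + 1)),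
      (∀ j ∈ J, a < (j : ℕ) ∧ (j : ℕ) < a + d - 1 ∧ x j ∉ F) →
      x t ∈ affineSpan ℝ (x '' ((basisIndex d n a : Set _) \ J)) := by
    intro J
    induction J using Finset.induction_on with
    | empty => intro _; simpa using hfull
    | insert j J hjJ ih =>
      intro hJ
      obtain ⟨h1, h2, h3⟩ := hJ j (Finset.mem_insert_self _ _)
      have ih' := ih fun i hi => hJ i (Finset.mem_insert_of_mem hi)
      have hjE : IsFacetIndex d n (indexE d n j) := Or.inr ⟨j, by omega, by omega, rfl⟩
      have hface := hQ.isFace hd hjE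
      have h0E : (0 : Fin (n + 1)) ∈ indexE d n j := Or.inl rfl
      obtain ⟨l, M, hl, hFe⟩ := hface.exists_functional ⟨_, hQ.1.mem_hull_iff.2 h0E⟩
      have hlM : ∀ i, l (x i) = M ↔ i ∈ indexE d n j := fun i => by
        rw [← hQ.1.mem_hull_iff, hFe]
        exact ⟨fun h => ⟨hQ.1.mem i, h⟩, fun h => h.2⟩
      refine mem_affineSpan_of_insert (v := x j) ⟨x 0, 0, ⟨?_, ?_⟩, rfl⟩ l (M := M) ?_ ?_ ?_ ?_
      · exact Finset.mem_coe.2 (mem_basisIndex.2 (Or.inl rfl))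
      · intro h
        have := (hJ 0 h).1
        simp at this
      · rintro _ ⟨i, ⟨hi1, hi2⟩, rfl⟩
        rw [hlM, mem_indexE]
        have hij : (i : ℕ) ≠ j := fun e => hi2 (by
          rw [Fin.ext e]; exact Finset.mem_coe.2 (Finset.mem_insert_self _ _))
        have := mem_basisIndex.1 (Finset.mem_coe.1 hi1)
        omega
      · rw [Ne, hlM, mem_indexE]
        omega
      · rw [hlM]
        exact hE j h1 h2 (fun h => h3 (val_mem_indexSet.1 h)) _ (val_mem_indexSet.2 ht)
      · rw [← Set.image_insert_eq]
        refine affineSpan_mono ℝ (Set.image_mono ?_) ih'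
        rintro i ⟨hi1, hi2⟩
        by_cases hij : i = j
        · exact Or.inl hij
        · exact Or.inr ⟨hi1, by
            rw [Finset.coe_insert]
            rintro (h | h)
            · exact hij h
            · exact hi2 h⟩
  refine affineSpan_mono ℝ (Set.image_mono ?_)
    (hJ (Finset.univ.filter fun j => a < (j : ℕ) ∧ (j : ℕ) < a + d - 1 ∧ x j ∉ F)
      fun j hj => (Finset.mem_filter.1 hj).2)
  rintro i ⟨hi1, hi2⟩
  have h1 := mem_basisIndex.1 (Finset.mem_coe.1 hi1)
  have h2 : ¬ (a < (i : ℕ) ∧ (i : ℕ) < a + d - 1 ∧ x i ∉ F) := fun h =>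
    hi2 (Finset.mem_coe.2 (Finset.mem_filter.2 ⟨Finset.mem_univ _, h⟩))
  refine ⟨?_, ?_⟩
  · by_cases e0 : (i : ℕ) = 0
    · rw [e0]; exact h0
    by_cases ea : (i : ℕ) = a
    · rw [ea]; exact haF
    by_cases eb : (i : ℕ) = a + d - 1
    · rw [eb]; exact hbF
    · by_contra h
      exact h2 ⟨by omega, by omega, fun h' => h (val_mem_indexSet.2 h')⟩
  · by_cases e0 : (i : ℕ) = 0
    · exact Or.inl e0
    · refine Or.inr fun s hs hs0 => ?_
      have := hmin s hs hs0
      omega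

open Classical in
/-- The window of a face, as a finite set of natural numbers. -/
noncomputable def faceWindow {X : Type*} (d : ℕ) (x : Fin (n + 1) → X) (F : Set X) :
    Finset ℕ :=
  (Finset.range (n + 1)).filter (· ∈ window d (indexSet x F))

theorem coe_faceWindow {X : Type*} {x : Fin (n + 1) → X} {F : Set X} :
    (faceWindow d x F : Set ℕ) = window d (indexSet x F) := by
  ext t
  simp only [faceWindow, Finset.coe_filter, Finset.mem_range, Set.mem_ofPred_eq]
  refine ⟨fun h => h.2, fun h => ⟨?_, h⟩⟩
  obtain ⟨i, rfl, -⟩ := h.1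
  exact i.2

open Classical in
/-- The dimension of a face is one less than the size of its window. -/
theorem IsBraxtope.pdim_face [FiniteDimensional ℝ E] (hQ : IsBraxtope d x Q)
    (hd : 3 ≤ d) (hF : IsFace Q F) (hn : F.Nonempty) :
    pdim F = ((faceWindow d x F).card : ℤ) - 1 := by
  set W : Finset (Fin (n + 1)) :=
    Finset.univ.filter fun i => (i : ℕ) ∈ window d (indexSet x F) with hWdef
  have hW : (W : Set (Fin (n + 1))) = {i : Fin (n + 1) | (i : ℕ) ∈ window d (indexSet x F)} := by
    ext i; simp [hWdef]
  have hcard : (faceWindow d x F).card = W.card := by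
    rw [← Finset.card_map Fin.valEmbedding]
    congr 1
    ext t
    rw [← Finset.mem_coe, coe_faceWindow]
    simp only [Finset.mem_map, hWdef, Finset.mem_filter, Finset.mem_univ, true_and,
      Fin.valEmbedding_apply]
    constructor
    · intro h
      obtain ⟨i, rfl, -⟩ := h.1
      exact ⟨i, h, rfl⟩
    · rintro ⟨i, h, rfl⟩
      exact h
  have hind : AffineIndependent ℝ fun i : W => x i := by
    refine hQ.affineIndependent hd fun s hs t ht hs0 => ?_
    have h1 := (hQ.isClosedIndex hd hF hn).isAdmissible_window hd
    exact h1.2.1 s (by simpa [hWdef] using hs) t (by simpa [hWdef] using ht) hs0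
  rw [hcard, ← pdim_hull_of_affineIndependent hind, pdim_convexHull, hW]
  have hspan := hQ.face_subset_affineSpan hd hF hn
  have hsub : x '' {i | (i : ℕ) ∈ window d (indexSet x F)} ⊆ F := by
    rintro _ ⟨i, hi, rfl⟩
    exact val_mem_indexSet.1 hi.1
  refine le_antisymm ?_ (pdim_mono hsub)
  have hne : (x '' {i | (i : ℕ) ∈ window d (indexSet x F)}).Nonempty := by
    rw [← affineSpan_nonempty ℝ]
    exact hn.mono hspan
  rw [pdim_of_nonempty hn, pdim_of_nonempty hne, ← direction_affineSpan, ← direction_affineSpan]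
  exact_mod_cast Submodule.finrank_mono
    (AffineSubspace.direction_le (affineSpan_le.2 hspan))

theorem IsBraxtope.faceWindow_injOn [FiniteDimensional ℝ E] (hQ : IsBraxtope d x Q)
    (hd : 3 ≤ d) : Set.InjOn (faceWindow d x) {F | IsFace Q F ∧ F.Nonempty} := by
  have key : ∀ F G : Set E, IsFace Q F → F.Nonempty → IsFace Q G → G.Nonempty →
      faceWindow d x F = faceWindow d x G → F ⊆ G := by
    intro F G hF hFn hG hGn h p hp
    refine hG.mem_of_mem_affineSpan (IsExposed.subset hF hp) ?_
    have h1 := hQ.face_subset_affineSpan hd hF hFn hp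
    rw [← coe_faceWindow, h, coe_faceWindow] at h1
    refine affineSpan_mono ℝ ?_ h1
    rintro _ ⟨i, hi, rfl⟩
    exact val_mem_indexSet.1 hi.1
  rintro F ⟨hF, hFn⟩ G ⟨hG, hGn⟩ h
  exact (key F G hF hFn hG hGn h).antisymm (key G F hG hGn hF hFn h.symm)

theorem IsBraxtope.image_faceWindow [FiniteDimensional ℝ E] (hQ : IsBraxtope d x Q)
    (hd : 3 ≤ d) {k : ℕ} : faceWindow d x '' {F | IsFace Q F ∧ pdim F = k} =
      {W : Finset ℕ | IsAdmissible d n W ∧ W.card = k + 1} := by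
  have hn := (hQ.2.2.2 hd).1
  have hne : ∀ F : Set E, pdim F = k → F.Nonempty := by
    intro F hF
    rw [Set.nonempty_iff_ne_empty]
    rintro rfl
    rw [pdim_empty] at hF
    omega
  ext W
  constructor
  · rintro ⟨F, ⟨hF, hFk⟩, rfl⟩
    refine ⟨?_, ?_⟩
    · rw [coe_faceWindow]
      exact (hQ.isClosedIndex hd hF (hne F hFk)).isAdmissible_window hd
    · have := hQ.pdim_face hd hF (hne F hFk)
      omega
  · rintro ⟨hW, hc⟩
    obtain ⟨A, hA, hAW⟩ := hW.exists_isClosedIndex hd hn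
    have hF := hQ.isFace_of_isClosedIndex hd hA
    have hi := mem_indexSet_hull hQ.1 hA.1
    have hWF : faceWindow d x (convexHull ℝ (x '' {i | (i : ℕ) ∈ A})) = W := by
      rw [← Finset.coe_inj, coe_faceWindow, hi, hAW]
    refine ⟨_, ⟨hF, ?_⟩, hWF⟩
    rw [hQ.pdim_face hd hF, hWF, hc]
    · push_cast; ring
    · obtain ⟨t, ht⟩ : W.Nonempty := Finset.card_pos.1 (by omega)
      have : t ∈ window d A := hAW ▸ ht
      rw [convexHull_nonempty_iff, Set.image_nonempty]
      exact ⟨⟨t, Nat.lt_succ_of_le (hA.1 t this.1)⟩, this.1⟩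

theorem IsBraxtope.faceCount_eq [FiniteDimensional ℝ E] (hQ : IsBraxtope d x Q)
    (hd : 3 ≤ d) (k : ℕ) :
    faceCount Q k = {W : Finset ℕ | IsAdmissible d n W ∧ W.card = k + 1}.ncard := by
  rw [← hQ.image_faceWindow hd, Set.InjOn.ncard_image]
  · rfl
  · refine (hQ.faceWindow_injOn hd).mono ?_
    rintro F ⟨hF, hFk⟩
    refine ⟨hF, ?_⟩
    rw [Set.nonempty_iff_ne_empty]
    rintro rfl
    rw [pdim_empty] at hFk
    omega

end

section

/-! ### Counting admissible sets -/

/-- The sets with `m + 1` elements whose least element `a` is in `I` and whose other elements are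
in `T a`. -/
def leastFamily (I : Finset ℕ) (T : ℕ → Finset ℕ) (m : ℕ) : Finset (Finset ℕ) :=
  I.biUnion fun a => ((T a).powersetCard m).image (insert a)

theorem mem_leastFamily {I : Finset ℕ} {T : ℕ → Finset ℕ} {m : ℕ}
    (hT : ∀ a ∈ I, ∀ t ∈ T a, a < t) {W : Finset ℕ} :
    W ∈ leastFamily I T m ↔
      ∃ a ∈ I, a ∈ W ∧ (∀ t ∈ W, t = a ∨ t ∈ T a) ∧ W.card = m + 1 := by
  simp only [leastFamily, Finset.mem_biUnion, Finset.mem_image, Finset.mem_powersetCard]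
  constructor
  · rintro ⟨a, ha, V, ⟨hV, hc⟩, rfl⟩
    have haV : a ∉ V := fun h => lt_irrefl _ (hT a ha a (hV h))
    refine ⟨a, ha, Finset.mem_insert_self _ _, fun t ht => ?_, ?_⟩
    · exact (Finset.mem_insert.1 ht).imp_right fun h => hV h
    · rw [Finset.card_insert_of_notMem haV, hc]
  · rintro ⟨a, ha, haW, h, hc⟩
    refine ⟨a, ha, W.erase a, ⟨fun t ht => ?_, ?_⟩, Finset.insert_erase haW⟩
    · exact (h t (Finset.mem_of_mem_erase ht)).resolve_left (Finset.ne_of_mem_erase ht)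
    · rw [Finset.card_erase_of_mem haW, hc, Nat.add_sub_cancel]

theorem card_leastFamily {I : Finset ℕ} {T : ℕ → Finset ℕ} {m : ℕ}
    (hT : ∀ a ∈ I, ∀ t ∈ T a, a < t) :
    (leastFamily I T m).card = ∑ a ∈ I, (T a).card.choose m := by
  have hnot : ∀ a ∈ I, ∀ V ⊆ T a, a ∉ V := fun a ha V hV h => lt_irrefl _ (hT a ha a (hV h))
  rw [leastFamily, Finset.card_biUnion]
  · refine Finset.sum_congr rfl fun a ha => ?_
    rw [Finset.card_image_of_injOn, Finset.card_powersetCard]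
    intro V hV V' hV' h
    have h1 := hnot a ha V (Finset.mem_powersetCard.1 (Finset.mem_coe.1 hV)).1
    have h2 := hnot a ha V' (Finset.mem_powersetCard.1 (Finset.mem_coe.1 hV')).1
    rw [← Finset.erase_insert h1, ← Finset.erase_insert h2]
    exact congrArg (Finset.erase · a) h
  · intro a ha b hb hab
    rw [Function.onFun, Finset.disjoint_left]
    intro W hW hW'
    obtain ⟨V, hV, rfl⟩ := Finset.mem_image.1 hW
    obtain ⟨V', hV', he⟩ := Finset.mem_image.1 hW'
    rw [Finset.mem_powersetCard] at hV hV'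
    have h1 : b ∈ insert a V := he ▸ Finset.mem_insert_self _ _
    have h2 : a ∈ insert b V' := he ▸ Finset.mem_insert_self _ _
    have h3 := hT a ha b (hV.1 ((Finset.mem_insert.1 h1).resolve_left hab.symm))
    have h4 := hT b hb a (hV'.1 ((Finset.mem_insert.1 h2).resolve_left hab))
    omega

theorem sum_choose_range (k m : ℕ) : ∑ i ∈ Finset.range k, i.choose m = k.choose (m + 1) := by
  induction k with
  | zero => simp
  | succ k ih => rw [Finset.sum_range_succ, ih, Nat.choose_succ_succ, add_comm]

theorem sum_choose_Ioc {k n m : ℕ} (h : k ≤ n) :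
    ∑ a ∈ Finset.Ioc (n - k) n, (n - a).choose m = k.choose (m + 1) := by
  rw [← sum_choose_range]
  refine Finset.sum_nbij' (fun a => n - a) (fun i => n - i) ?_ ?_ ?_ ?_ ?_
  all_goals intro a ha
  all_goals simp only [Finset.mem_Ioc, Finset.mem_range] at *
  all_goals omega

variable {d n : ℕ}

/-- The possible elements above the least element `a` in an admissible set without `0`. -/
def tailWithoutZero (d n a : ℕ) : Finset ℕ := Finset.Icc (a + 1) (min n (a + d - 1))

/-- The possible elements above the least nonzero element `a` in an admissible set with `0`. -/
def tailWithZero (d n a : ℕ) : Finset ℕ :=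
  (tailWithoutZero d n a).filter fun t => 2 ≤ a → a + d ≤ n + 1 → t ≠ a + d - 2

theorem card_family_without_zero (hd : 3 ≤ d) (hn : d ≤ n) (m : ℕ) :
    (leastFamily (Finset.Icc 1 n) (tailWithoutZero d n) m).card =
      d.choose (m + 1) + (n - d) * (d - 1).choose m := by
  rw [card_leastFamily (by simp only [tailWithoutZero, Finset.mem_Icc]; omega)]
  have hI : Finset.Icc 1 n = Finset.Icc 1 (n - d) ∪ Finset.Ioc (n - d) n := by
    ext a; simp only [Finset.mem_Icc, Finset.mem_union, Finset.mem_Ioc]; omega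
  rw [hI, Finset.sum_union (Finset.disjoint_left.2 fun a h1 h2 => by
    simp only [Finset.mem_Icc, Finset.mem_Ioc] at h1 h2; omega), ← sum_choose_Ioc hn, add_comm]
  congr 1
  · refine Finset.sum_congr rfl fun a ha => ?_
    rw [Finset.mem_Ioc] at ha
    rw [tailWithoutZero, Nat.card_Icc]
    congr 1
    omega
  · rw [Finset.sum_congr rfl (g := fun _ => (d - 1).choose m)]
    · simp
    intro a ha
    rw [Finset.mem_Icc] at ha
    rw [tailWithoutZero, Nat.card_Icc]
    congr 1
    omega

theorem card_family_with_zero (hd : 3 ≤ d) (hn : d ≤ n) (m : ℕ) :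
    (leastFamily (Finset.Icc 1 n) (tailWithZero d n) m).card =
      (d - 1).choose (m + 1) + (d - 1).choose m + (n - d) * (d - 2).choose m := by
  rw [card_leastFamily (by
    simp only [tailWithZero, tailWithoutZero, Finset.mem_filter, Finset.mem_Icc]; omega)]
  have hI : Finset.Icc 1 n = insert 1 (Finset.Icc 2 (n + 1 - d) ∪ Finset.Ioc (n - (d - 1)) n) := by
    ext a; simp only [Finset.mem_Icc, Finset.mem_union, Finset.mem_Ioc, Finset.mem_insert]; omega
  rw [hI, Finset.sum_insert (by
      simp only [Finset.mem_Icc, Finset.mem_union, Finset.mem_Ioc]; omega),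
    Finset.sum_union (Finset.disjoint_left.2 fun a h1 h2 => by
    simp only [Finset.mem_Icc, Finset.mem_Ioc] at h1 h2; omega),
    ← sum_choose_Ioc (show d - 1 ≤ n by omega)]
  have h1 : (tailWithZero d n 1).card = d - 1 := by
    rw [tailWithZero, Finset.filter_true_of_mem (by omega), tailWithoutZero, Nat.card_Icc]
    omega
  have h2 : ∑ a ∈ Finset.Icc 2 (n + 1 - d), (tailWithZero d n a).card.choose m =
      (n - d) * (d - 2).choose m := by
    rw [Finset.sum_congr rfl (g := fun _ => (d - 2).choose m)]
    · rw [Finset.sum_const, Nat.card_Icc, smul_eq_mul]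
      congr 1
      omega
    intro a ha
    rw [Finset.mem_Icc] at ha
    have : tailWithZero d n a = (tailWithoutZero d n a).erase (a + d - 2) := by
      ext t
      simp only [tailWithZero, Finset.mem_filter, Finset.mem_erase]
      refine ⟨fun h => ⟨h.2 (by omega) (by omega), h.1⟩, fun h => ⟨h.2, fun _ _ => h.1⟩⟩
    rw [this, Finset.card_erase_of_mem (by rw [tailWithoutZero, Finset.mem_Icc]; omega),
      tailWithoutZero, Nat.card_Icc]
    congr 1
    omega
  have h3 : ∑ a ∈ Finset.Ioc (n - (d - 1)) n, (tailWithZero d n a).card.choose m =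
      ∑ a ∈ Finset.Ioc (n - (d - 1)) n, (n - a).choose m := by
    refine Finset.sum_congr rfl fun a ha => ?_
    rw [Finset.mem_Ioc] at ha
    rw [tailWithZero, Finset.filter_true_of_mem (by omega), tailWithoutZero, Nat.card_Icc]
    congr 1
    omega
  rw [h1, h2, h3]
  ring

theorem isAdmissible_iff_of_zero_notMem (hd : 3 ≤ d) {m : ℕ} {W : Finset ℕ} (h0 : 0 ∉ W) :
    IsAdmissible d n W ∧ W.card = m + 1 ↔
      W ∈ leastFamily (Finset.Icc 1 n) (tailWithoutZero d n) m := by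
  rw [mem_leastFamily (by simp only [tailWithoutZero, Finset.mem_Icc]; omega)]
  have hne0 : ∀ t ∈ W, t ≠ 0 := fun t ht e => h0 (e ▸ ht)
  simp only [tailWithoutZero, Finset.mem_Icc]
  constructor
  · rintro ⟨⟨h1, h2, -⟩, hc⟩
    have hne : W.Nonempty := Finset.card_pos.1 (by omega)
    have ha := W.min'_mem hne
    have hmin : ∀ t ∈ W, W.min' hne ≤ t := fun t ht => W.min'_le t ht
    refine ⟨W.min' hne, ⟨Nat.pos_of_ne_zero (hne0 _ ha), h1 _ ha⟩, ha, fun t ht => ?_, hc⟩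
    have := h1 t ht
    have := h2 _ ha t ht (hne0 _ ha)
    have := hmin t ht
    omega
  · rintro ⟨a, ha1, haW, h, hc⟩
    refine ⟨⟨fun t ht => ?_, fun s hs t ht hs0 => ?_, fun h => absurd h h0⟩, hc⟩
    · have := h t ht
      omega
    · have := h t ht
      have := h s hs
      omega

theorem isAdmissible_iff_of_zero_mem (hd : 3 ≤ d) {m : ℕ} {W : Finset ℕ} (h0 : 0 ∈ W) :
    IsAdmissible d n W ∧ W.card = m + 2 ↔
      W.erase 0 ∈ leastFamily (Finset.Icc 1 n) (tailWithZero d n) m := by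
  rw [mem_leastFamily (by
    simp only [tailWithZero, tailWithoutZero, Finset.mem_filter, Finset.mem_Icc]; omega),
    Finset.card_erase_of_mem h0]
  simp only [tailWithZero, tailWithoutZero, Finset.mem_Icc, Finset.mem_filter, Finset.mem_erase]
  constructor
  · rintro ⟨⟨h1, h2, h3⟩, hc⟩
    have hne : (W.erase 0).Nonempty := Finset.card_pos.1 (by
      rw [Finset.card_erase_of_mem h0]; omega)
    have ha := (W.erase 0).min'_mem hne
    have hmin : ∀ t ∈ W, t ≠ 0 → (W.erase 0).min' hne ≤ t := fun t ht ht0 =>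
      (W.erase 0).min'_le t (Finset.mem_erase.2 ⟨ht0, ht⟩)
    set a := (W.erase 0).min' hne
    rw [Finset.mem_erase] at ha
    refine ⟨a, ⟨by omega, h1 _ ha.2⟩, ha, fun t ⟨ht0, ht⟩ => ?_, by omega⟩
    have e1 := h1 t ht
    have e2 := h2 _ ha.2 t ht ha.1
    have e3 := hmin t ht ht0
    rw [or_iff_not_imp_left]
    intro hta
    refine ⟨by omega, fun ha2 had e => ?_⟩
    exact h3 h0 a ha.2 ha2 had hmin (e ▸ ht)
  · rintro ⟨a, ha1, ⟨ha0, haW⟩, h, hc⟩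
    refine ⟨⟨fun t ht => ?_, fun s hs t ht hs0 => ?_, fun _ b hb hb2 hbd hmin hcon => ?_⟩, ?_⟩
    · by_cases ht0 : t = 0
      · omega
      · have := h t ⟨ht0, ht⟩
        omega
    · have := h s ⟨hs0, hs⟩
      by_cases ht0 : t = 0
      · omega
      · have := h t ⟨ht0, ht⟩
        omega
    · have e1 := hmin a haW ha0
      have e2 := h b ⟨by omega, hb⟩
      have e3 : b = a := by omega
      subst e3
      rcases h _ ⟨by omega, hcon⟩ with e | e
      · omega
      · exact e.2 hb2 hbd rfl
    · have := Finset.card_pos.2 ⟨0, h0⟩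
      omega

theorem ncard_isAdmissible (hd : 3 ≤ d) (hn : d ≤ n) (m : ℕ) :
    {W : Finset ℕ | IsAdmissible d n W ∧ W.card = m + 2}.ncard =
      (d + 1).choose (m + 2) + (n - d) * ((d - 1).choose (m + 1) + (d - 2).choose m) := by
  have hz1 : ∀ W ∈ leastFamily (Finset.Icc 1 n) (tailWithoutZero d n) (m + 1), 0 ∉ W := by
    intro W hW h0
    rw [mem_leastFamily (by simp only [tailWithoutZero, Finset.mem_Icc]; omega)] at hW
    obtain ⟨a, ha, -, h, -⟩ := hW
    have := h 0 h0
    simp only [tailWithoutZero, Finset.mem_Icc] at this ha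
    omega
  have hz2 : ∀ W ∈ leastFamily (Finset.Icc 1 n) (tailWithZero d n) m, 0 ∉ W := by
    intro W hW h0
    rw [mem_leastFamily (by
      simp only [tailWithZero, tailWithoutZero, Finset.mem_filter, Finset.mem_Icc]; omega)] at hW
    obtain ⟨a, ha, -, h, -⟩ := hW
    have := h 0 h0
    simp only [tailWithZero, tailWithoutZero, Finset.mem_filter, Finset.mem_Icc] at this ha
    omega
  have he : {W : Finset ℕ | IsAdmissible d n W ∧ W.card = m + 2} =
      ((leastFamily (Finset.Icc 1 n) (tailWithoutZero d n) (m + 1) ∪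
        (leastFamily (Finset.Icc 1 n) (tailWithZero d n) m).image (insert 0) :
          Finset (Finset ℕ)) : Set (Finset ℕ)) := by
    ext W
    rw [Finset.mem_coe, Finset.mem_union, Finset.mem_image]
    by_cases h0 : 0 ∈ W
    · refine (isAdmissible_iff_of_zero_mem hd h0).trans ⟨fun h => Or.inr ⟨_, h,
        Finset.insert_erase h0⟩, ?_⟩
      rintro (h | ⟨V, hV, rfl⟩)
      · exact absurd h0 (hz1 W h)
      · rwa [Finset.erase_insert (hz2 V hV)]
    · refine (isAdmissible_iff_of_zero_notMem hd h0).trans ⟨Or.inl, ?_⟩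
      rintro (h | ⟨V, hV, rfl⟩)
      · exact h
      · exact absurd (Finset.mem_insert_self _ _) h0
  rw [he, Set.ncard_coe_finset, Finset.card_union_of_disjoint, card_family_without_zero hd hn,
    Finset.card_image_of_injOn, card_family_with_zero hd hn]
  · obtain ⟨e, rfl⟩ : ∃ e, d = e + 2 := ⟨d - 2, by omega⟩
    simp only [Nat.add_sub_cancel, show e + 2 - 1 = e + 1 by omega]
    rw [Nat.choose_succ_succ (e + 2) (m + 1), Nat.choose_succ_succ (e + 1) m]
    ring
  · intro V hV V' hV' h
    rw [← Finset.erase_insert (hz2 V hV), ← Finset.erase_insert (hz2 V' hV')]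
    exact congrArg (Finset.erase · 0) h
  · rw [Finset.disjoint_left]
    intro W hW hW'
    obtain ⟨V, -, rfl⟩ := Finset.mem_image.1 hW'
    exact hz1 _ hW (Finset.mem_insert_self _ _)

theorem ncard_isAdmissible_one (hd : 3 ≤ d) :
    {W : Finset ℕ | IsAdmissible d n W ∧ W.card = 1}.ncard = n + 1 := by
  have he : {W : Finset ℕ | IsAdmissible d n W ∧ W.card = 1} =
      (((Finset.range (n + 1)).image fun t => ({t} : Finset ℕ) :
        Finset (Finset ℕ)) : Set (Finset ℕ)) := by
    ext W
    rw [Finset.mem_coe, Finset.mem_image]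
    constructor
    · rintro ⟨⟨h, -, -⟩, hc⟩
      obtain ⟨t, rfl⟩ := Finset.card_eq_one.1 hc
      exact ⟨t, Finset.mem_range_succ_iff.2 (h t (by simp)), rfl⟩
    · rintro ⟨t, ht, rfl⟩
      rw [Finset.mem_range] at ht
      refine ⟨⟨?_, ?_, ?_⟩, Finset.card_singleton t⟩
      all_goals simp only [Finset.coe_singleton, Set.mem_singleton_iff]
      all_goals omega
  rw [he, Set.ncard_coe_finset, Finset.card_image_of_injective _ Finset.singleton_injective,
    Finset.card_range]

variable {E : Type*} [NormedAddCommGroup E] [NormedSpace ℝ E] {x : Fin (n + 1) → E} {Q : Set E}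

theorem IsBraxtope.faceCount_binom [FiniteDimensional ℝ E] (hQ : IsBraxtope d x Q) (hd : 3 ≤ d)
    (j : ℤ) (hj : -1 ≤ j) : faceCount Q j = binom (d + 1) (j + 1) +
      (n - d) * (binom (d - 1) j + binom (d - 2) (j - 1)) := by
  have hn := (hQ.2.2.2 hd).1
  rcases eq_or_lt_of_le hj with rfl | hj
  · have : {F : Set E | IsFace Q F ∧ pdim F = -1} = {∅} := by
      ext F
      constructor
      · rintro ⟨-, hF⟩
        by_contra hne
        have := pdim_nonneg (Set.nonempty_iff_ne_empty.2 hne)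
        omega
      · rintro rfl
        exact ⟨isExposed_empty, pdim_empty⟩
    rw [faceCount, this, Set.ncard_singleton]
    simp [binom]
  lift j to ℕ using by omega
  rw [hQ.faceCount_eq hd]
  rcases j with _ | m
  · rw [ncard_isAdmissible_one hd]
    simp [binom]
    omega
  · rw [ncard_isAdmissible hd hn]
    have h1 : ((m + 1 : ℕ) : ℤ) + 1 = (m + 2 : ℕ) := by push_cast; ring
    have h2 : ((m + 1 : ℕ) : ℤ) - 1 = (m : ℕ) := by push_cast; ring
    have h3 : ∀ a b : ℕ, binom a b = a.choose b := fun a b => by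
      rw [binom, if_neg (by omega), Int.toNat_natCast]
    rw [h1, h2, h3, h3, h3]

end

section

variable {E : Type*} [NormedAddCommGroup E] [NormedSpace ℝ E]
variable {d n : ℕ} {x : Fin (n + 1) → E} {P Q F G : Set E}

/-! ### Simplices are braxtopes -/

theorem affineIndependent_of_pdim_eq [FiniteDimensional ℝ E] (h : IsVertexArray P x)
    (hP : pdim P = n) : AffineIndependent ℝ x := by
  rw [affineIndependent_iff_le_finrank_vectorSpan ℝ x (n := n) (by simp)]
  rw [h.eq_convexHull, pdim_convexHull, pdim_of_nonempty (Set.range_nonempty x)] at hP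
  exact_mod_cast hP.ge

theorem pdim_hull_finset [FiniteDimensional ℝ E] (hx : AffineIndependent ℝ x)
    (A : Finset (Fin (n + 1))) : pdim (convexHull ℝ (x '' A)) = (A.card : ℤ) - 1 :=
  pdim_hull_of_affineIndependent (hx.comp_embedding (Function.Embedding.subtype (· ∈ A)))

/-- The facets of a simplex are opposite to its vertices. -/
theorem IsVertexArray.isFacet_simplex_iff [FiniteDimensional ℝ E] (h : IsVertexArray P x)
    (hn : 1 ≤ n) (hP : pdim P = n) :
    IsFacet P F ↔ ∃ i, F = convexHull ℝ (x '' {i}ᶜ) := by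
  classical
  have hx := affineIndependent_of_pdim_eq h hP
  have key : ∀ F, IsFacet P F → ∃ i, F = convexHull ℝ (x '' {i}ᶜ) := by
    intro F hF
    have hFe := h.face_eq_hull hF.1
    have hA : {i | x i ∈ F} = ((Finset.univ.filter fun i => x i ∈ F : Finset _) : Set _) := by
      simp
    have hdim := hF.2
    rw [hFe, hA, pdim_hull_finset hx, hP] at hdim
    have hc := Finset.card_add_card_compl (Finset.univ.filter fun i => x i ∈ F)
    rw [Fintype.card_fin] at hc
    obtain ⟨i, hi⟩ := Finset.card_eq_one.1
      (show (Finset.univ.filter fun i => x i ∈ F)ᶜ.card = 1 by omega)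
    refine ⟨i, ?_⟩
    rw [hFe, hA, ← compl_compl (Finset.univ.filter fun i => x i ∈ F), hi]
    simp
  refine ⟨key F, ?_⟩
  rintro ⟨i, rfl⟩
  have : Nontrivial (Fin (n + 1)) := Fin.nontrivial_iff_two_le.2 (by omega)
  obtain ⟨k, hk⟩ := exists_ne i
  obtain ⟨G, hG, hkG, hiG⟩ := h.exists_facet (h.isFace_singleton k) (Set.singleton_nonempty _)
    (h.mem i) (fun e => hk (h.injective e).symm)
  obtain ⟨j, rfl⟩ := key G hG
  rw [h.mem_hull_iff, Set.mem_compl_singleton_iff, not_not] at hiG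
  exact hiG ▸ hG

theorem isFacetIndex_simplex_iff (hn : 3 ≤ n) {B : Set (Fin (n + 1))} :
    IsFacetIndex n n B ↔ ∃ i, B = {i}ᶜ := by
  have hext : ∀ (B : Set (Fin (n + 1))) (i : Fin (n + 1)),
      (∀ t : Fin (n + 1), t ∈ B ↔ (t : ℕ) ≠ i) → B = {i}ᶜ := fun B i hB => by
    ext t
    rw [hB, Set.mem_compl_singleton_iff, Ne, Ne, Fin.ext_iff]
  constructor
  · rintro (⟨i, hi, rfl⟩ | ⟨j, h2, hj, rfl⟩)
    · refine ⟨⟨if i = 0 then n else 0, by split_ifs <;> omega⟩, hext _ _ fun t => ?_⟩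
      rw [mem_indexT]
      have := t.2
      simp only
      split_ifs <;> omega
    · refine ⟨⟨if j = n then 1 else j, by split_ifs <;> omega⟩, hext _ _ fun t => ?_⟩
      rw [mem_indexE]
      have := t.2
      simp only
      split_ifs <;> omega
  · rintro ⟨i, rfl⟩
    have hi := i.2
    by_cases e0 : (i : ℕ) = 0
    · refine Or.inl ⟨1, by omega, (hext _ _ fun t => ?_).symm⟩
      rw [mem_indexT]; omega
    by_cases e1 : (i : ℕ) = n
    · refine Or.inl ⟨0, by omega, (hext _ _ fun t => ?_).symm⟩
      rw [mem_indexT]; omega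
    by_cases e2 : (i : ℕ) = 1
    · refine Or.inr ⟨n, by omega, le_rfl, (hext _ _ fun t => ?_).symm⟩
      rw [mem_indexE]; omega
    · refine Or.inr ⟨i, by omega, by omega, (hext _ _ fun t => ?_).symm⟩
      rw [mem_indexE]; omega

theorem isBraxtope_simplex [FiniteDimensional ℝ E] (h : IsVertexArray P x) (hP : pdim P = n) :
    IsBraxtope n x P := by
  by_cases hn : 3 ≤ n
  · refine isBraxtope_of_isFacet_iff h hP hn le_rfl fun F => ?_
    rw [h.isFacet_simplex_iff (by omega) hP]
    constructor
    · rintro ⟨i, hi⟩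
      exact ⟨_, (isFacetIndex_simplex_iff hn).2 ⟨i, rfl⟩, hi⟩
    · rintro ⟨B, hB, rfl⟩
      obtain ⟨i, rfl⟩ := (isFacetIndex_simplex_iff hn).1 hB
      exact ⟨i, rfl⟩
  · exact ⟨h, hP, fun _ => ⟨rfl, affineIndependent_of_pdim_eq h hP⟩, fun h => absurd h hn⟩

theorem exists_isBraxtope_of_simplex [FiniteDimensional ℝ E] (h : IsVertexArray P x)
    (hP : pdim P = n) (hF : IsFace P F) (hFn : F.Nonempty) :
    ∃ (m : ℕ) (σ : Fin (m + 1) ↪o Fin (n + 1)), IsBraxtope m (x ∘ σ) F := by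
  classical
  set A : Finset (Fin (n + 1)) := Finset.univ.filter fun i => x i ∈ F with hAdef
  obtain ⟨i, hi⟩ := h.exists_mem_face hF hFn
  have hpos : 0 < A.card := Finset.card_pos.2 ⟨i, by simpa [hAdef] using hi⟩
  have hc : A.card = (A.card - 1) + 1 := by omega
  refine ⟨A.card - 1, A.orderEmbOfFin hc, isBraxtope_simplex ?_ ?_⟩
  · refine h.face hF _ (A.orderEmbOfFin hc).injective fun i => ?_
    rw [Finset.range_orderEmbOfFin]
    simp [hAdef]
  · have hA : {i | x i ∈ F} = (A : Set (Fin (n + 1))) := by simp [hAdef]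
    rw [h.face_eq_hull hF, hA, pdim_hull_finset (affineIndependent_of_pdim_eq h hP)]
    omega

/-! ### Facets of braxtopes are braxtopes -/

/-- No facet of a braxtope contains another one. -/
theorem isFacetIndex_antichain (hd : 3 ≤ d) (hn : d ≤ n) {B B' : Set (Fin (n + 1))}
    (hB : IsFacetIndex d n B) (hB' : IsFacetIndex d n B') (h : B ⊆ B') : B = B' := by
  have hs : ∀ t (ht : t ≤ n), (⟨t, Nat.lt_succ_of_le ht⟩ : Fin (n + 1)) ∈ B →
      (⟨t, Nat.lt_succ_of_le ht⟩ : Fin (n + 1)) ∈ B' := fun t ht h' => h h'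
  rcases hB with ⟨i, hi, rfl⟩ | ⟨j, h2, hj, rfl⟩ <;>
    rcases hB' with ⟨i', hi', rfl⟩ | ⟨j', h2', hj', rfl⟩ <;>
    simp only [mem_indexT, mem_indexE] at hs
  · have e1 := hs i (by omega)
    have e2 := hs (i + d - 1) (by omega)
    have : i = i' := by omega
    rw [this]
  · exfalso
    by_cases hi0 : i = 0
    · have e1 := hs 1 (by omega)
      have e2 := hs (d - 1) (by omega)
      have e3 := hs j' (by omega)
      omega
    · have e1 := hs i (by omega)
      have e2 := hs (i + d - 1) (by omega)
      have e3 := hs j' (by omega)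
      omega
  · exfalso
    have e0 := hs 0 (by omega)
    by_cases h : j + d - 2 ≤ n
    · have e1 := hs (j + d - 2) h
      omega
    · have e1 := hs n le_rfl
      omega
  · suffices j = j' by rw [this]
    by_contra hne
    have e1 := hs j' hj'
    have e3 := hs n le_rfl
    have e4 := hs (j + 2 - d) (by omega)
    have e5 := hs 1 (by omega)
    by_cases hh : j + d - 2 ≤ n
    · have e2 := hs (j + d - 2) hh
      omega
    · omega

/-- A family of proper faces forming an antichain and covering all facets consists of all the
facets. -/
theorem IsVertexArray.isFacet_iff_of_cover [FiniteDimensional ℝ E] (h : IsVertexArray P x)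
    {𝓛 : Set (Fin (n + 1)) → Prop} (hface : ∀ L, 𝓛 L → IsFace P (convexHull ℝ (x '' L)))
    (hne : ∀ L, 𝓛 L → L.Nonempty) (hproper : ∀ L, 𝓛 L → L ≠ Set.univ)
    (hcover : ∀ G, IsFacet P G → ∃ L, 𝓛 L ∧ G ⊆ convexHull ℝ (x '' L))
    (hanti : ∀ L L', 𝓛 L → 𝓛 L' → L ⊆ L' → L = L') :
    IsFacet P F ↔ ∃ L, 𝓛 L ∧ F = convexHull ℝ (x '' L) := by
  have key : ∀ L, 𝓛 L → IsFacet P (convexHull ℝ (x '' L)) := by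
    intro L hL
    obtain ⟨i, hi⟩ := (Set.ne_univ_iff_exists_notMem L).1 (hproper L hL)
    obtain ⟨G, hG, hLG, -⟩ := h.exists_facet (hface L hL) ((hne L hL).image x).convexHull
      (h.mem i) (fun e => hi (h.mem_hull_iff.1 e))
    obtain ⟨L', hL', hGL'⟩ := hcover G hG
    have := hanti L L' hL hL' (h.hull_subset_iff.1 (hLG.trans hGL'))
    subst this
    rwa [hLG.antisymm hGL']
  constructor
  · intro hF
    obtain ⟨L, hL, hFL⟩ := hcover F hF
    refine ⟨L, hL, hF.1.eq_of_pdim_le (h.hull_subset L) hFL ?_⟩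
    rw [hF.2, (key L hL).2]
  · rintro ⟨L, hL, rfl⟩
    exact key L hL

/-- The position in the vertex array of the `t`-th vertex of `E_j`, where `s = j + 1 - d`
(truncated) is the number of positive indices below the least one in `E_j`. -/
def facetPos (s j t : ℕ) : ℕ := if t = 0 then 0 else if t + s < j then t + s else t + s + 1

theorem facetPos_cases (s j t : ℕ) : t = 0 ∧ facetPos s j t = 0 ∨
    t ≠ 0 ∧ t + s < j ∧ facetPos s j t = t + s ∨
    t ≠ 0 ∧ j ≤ t + s ∧ facetPos s j t = t + s + 1 := by
  unfold facetPos
  split_ifs <;> omega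

theorem exists_facetPos_iff {j m s t : ℕ} (hd : 3 ≤ d) (hj : 2 ≤ j) (hjn : j < n)
    (hs : s = j + 1 - d) (hm : m = min n (j + d - 2) - s - 1) (ht : t ≤ n) :
    (∃ k ≤ m, facetPos s j k = t) ↔ InE d n j t := by
  constructor
  · rintro ⟨k, hk, rfl⟩
    have := facetPos_cases s j k
    unfold InE
    omega
  · intro h
    unfold InE at h
    have h0 := facetPos_cases s j 0
    have h1 := facetPos_cases s j (t - s)
    have h2 := facetPos_cases s j (t - s - 1)
    by_cases e0 : t = 0
    · exact ⟨0, by omega, by omega⟩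
    by_cases e1 : t < j
    · exact ⟨t - s, by omega, by omega⟩
    · exact ⟨t - s - 1, by omega, by omega⟩

/-- Every prospective facet `E_k` of `E_j` is the intersection of `E_j` with a facet. -/
theorem exists_inE_iff_facetPos {j m s k : ℕ} (hd : 4 ≤ d) (hj : 2 ≤ j) (hjn : j < n)
    (hs : s = j + 1 - d) (hm : m = min n (j + d - 2) - s - 1) (h2 : 2 ≤ k) (hk : k ≤ m) :
    ∃ j', 2 ≤ j' ∧ j' ≤ n ∧ ∀ t ≤ m, InE (d - 1) m k t ↔ InE d n j' (facetPos s j t) := by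
  have hφ := facetPos_cases s j k
  by_cases hkm : k = m ∧ j + d - 2 < n
  · refine ⟨j + d - 1, by omega, by omega, fun t ht => ?_⟩
    have := facetPos_cases s j t
    unfold InE
    omega
  · refine ⟨facetPos s j k, by omega, by omega, fun t ht => ?_⟩
    have := facetPos_cases s j t
    unfold InE
    rcases hφ with h | h | h <;> rcases this with h' | h' | h' <;> omega

/-- Every prospective facet `T_i` of `E_j` is the intersection of `E_j` with a facet. -/
theorem exists_inT_iff_facetPos {j m s i : ℕ} (hd : 4 ≤ d) (hj : 2 ≤ j) (hjn : j < n)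
    (hs : s = j + 1 - d) (hm : m = min n (j + d - 2) - s - 1) (hi : i + (d - 1) ≤ m + 1) :
    (∃ i', i' + d ≤ n + 1 ∧ ∀ t ≤ m, (i ≤ t ∧ t < i + (d - 1)) ↔
      i' ≤ facetPos s j t ∧ facetPos s j t < i' + d) ∨
    ∃ j', 2 ≤ j' ∧ j' ≤ n ∧ ∀ t ≤ m, (i ≤ t ∧ t < i + (d - 1)) ↔ InE d n j' (facetPos s j t) := by
  by_cases hi0 : i = 0
  · by_cases hs1 : s ≤ 1
    · refine Or.inl ⟨0, by omega, fun t ht => ?_⟩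
      have := facetPos_cases s j t
      omega
    · refine Or.inr ⟨s, by omega, by omega, fun t ht => ?_⟩
      have := facetPos_cases s j t
      unfold InE
      omega
  · have hφ := facetPos_cases s j i
    refine Or.inl ⟨facetPos s j i, by omega, fun t ht => ?_⟩
    have := facetPos_cases s j t
    omega

/-- The intersection of `E_j` with a different facet lies in a prospective facet of `E_j`. -/
theorem exists_cover_of_inT {j m s i : ℕ} (hd : 4 ≤ d) (hj : 2 ≤ j) (hjn : j < n)
    (hs : s = j + 1 - d) (hm : m = min n (j + d - 2) - s - 1) (hi : i + d ≤ n + 1) :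
    ∃ i', i' + (d - 1) ≤ m + 1 ∧ ∀ t ≤ m,
      i ≤ facetPos s j t ∧ facetPos s j t < i + d → i' ≤ t ∧ t < i' + (d - 1) := by
  by_cases hi0 : i = 0
  · refine ⟨0, by omega, fun t ht => ?_⟩
    have := facetPos_cases s j t
    omega
  by_cases his : i ≤ s
  · refine ⟨1, by omega, fun t ht => ?_⟩
    have := facetPos_cases s j t
    omega
  by_cases hi' : i - s + (d - 1) ≤ m + 1
  · by_cases hij : i < j
    · refine ⟨i - s, by omega, fun t ht => ?_⟩
      have := facetPos_cases s j t
      omega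
    · refine ⟨i - s - 1, by omega, fun t ht => ?_⟩
      have := facetPos_cases s j t
      omega
  · refine ⟨m + 1 - (d - 1), by omega, fun t ht => ?_⟩
    have := facetPos_cases s j t
    omega

theorem exists_cover_of_inE {j m s j' : ℕ} (hd : 4 ≤ d) (hj : 2 ≤ j) (hjn : j < n)
    (hs : s = j + 1 - d) (hm : m = min n (j + d - 2) - s - 1) (hj' : 2 ≤ j') (hjn' : j' ≤ n)
    (hne : j ≠ j') :
    (∀ t ≤ m, InE d n j' (facetPos s j t) → t < d - 1) ∨
    ∃ k, 2 ≤ k ∧ k ≤ m ∧ ∀ t ≤ m, InE d n j' (facetPos s j t) → InE (d - 1) m k t := by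
  by_cases h1 : j' ≤ s + 1 ∧ 1 ≤ s
  · refine Or.inl fun t ht => ?_
    have := facetPos_cases s j t
    unfold InE
    omega
  right
  by_cases h2 : j + d - 2 ≤ j'
  · refine ⟨m, by omega, le_rfl, fun t ht => ?_⟩
    have := facetPos_cases s j t
    unfold InE
    omega
  by_cases h3 : j' < j
  · refine ⟨j' - s, by omega, by omega, fun t ht => ?_⟩
    have := facetPos_cases s j t
    unfold InE
    omega
  · refine ⟨j' - s - 1, by omega, by omega, fun t ht => ?_⟩
    have := facetPos_cases s j t
    unfold InE
    omega

end

section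

variable {E : Type*} [NormedAddCommGroup E] [NormedSpace ℝ E]
variable {d n : ℕ} {x : Fin (n + 1) → E} {P Q F G : Set E}

/-- A facet all of whose `d` vertices are listed by `σ` is a simplex. -/
theorem IsBraxtope.isBraxtope_facet_of_card [FiniteDimensional ℝ E] (hQ : IsBraxtope d x Q)
    (hd : 3 ≤ d) {B : Set (Fin (n + 1))} (hB : IsFacetIndex d n B) {m : ℕ} (hm : m + 1 = d)
    (σ : Fin (m + 1) ↪o Fin (n + 1)) (hσ : ∀ i, i ∈ Set.range σ ↔ i ∈ B) :
    IsBraxtope (d - 1) (x ∘ σ) (convexHull ℝ (x '' B)) := by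
  have hF := hQ.isFacet hd hB
  obtain rfl : m = d - 1 := by omega
  refine isBraxtope_simplex (hQ.1.face hF.1 σ σ.injective fun i => ?_) ?_
  · rw [hσ, hQ.1.mem_hull_iff]
  · rw [hF.2, hQ.2.1]
    omega

/-- For `2 ≤ j < n` the facet `E_j` is a braxtope. -/
theorem IsBraxtope.facetE [FiniteDimensional ℝ E] (hQ : IsBraxtope d x Q) (hd : 3 ≤ d) {j : ℕ}
    (hj : 2 ≤ j) (hjn : j < n) {m : ℕ} (hm : m = min n (j + d - 2) - (j + 1 - d) - 1) :
    ∃ σ : Fin (m + 1) ↪o Fin (n + 1),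
      IsBraxtope (d - 1) (x ∘ σ) (convexHull ℝ (x '' indexE d n j)) := by
  have hn := (hQ.2.2.2 hd).1
  obtain ⟨s, hs⟩ : ∃ s, s = j + 1 - d := ⟨_, rfl⟩
  rw [← hs] at hm
  have hB : IsFacetIndex d n (indexE d n j) := Or.inr ⟨j, hj, hjn.le, rfl⟩
  have hφ : ∀ t : Fin (m + 1), facetPos s j t < n + 1 := fun t => by
    have := facetPos_cases s j t
    omega
  let σ : Fin (m + 1) ↪o Fin (n + 1) := OrderEmbedding.ofStrictMono
    (fun t => ⟨facetPos s j t, hφ t⟩) fun a b hab => by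
      have h1 := facetPos_cases s j a
      have h2 := facetPos_cases s j b
      rw [Fin.lt_def] at hab ⊢
      simp only
      omega
  have hσv : ∀ t, (σ t : ℕ) = facetPos s j t := fun t => rfl
  have hσ : ∀ i, i ∈ Set.range σ ↔ i ∈ indexE d n j := by
    intro i
    refine Iff.trans ?_ (exists_facetPos_iff hd hj hjn hs hm (Nat.le_of_lt_succ i.2))
    constructor
    · rintro ⟨k, rfl⟩
      exact ⟨k, Nat.le_of_lt_succ k.2, rfl⟩
    · rintro ⟨k, hk, hki⟩
      exact ⟨⟨k, Nat.lt_succ_of_le hk⟩, Fin.ext hki⟩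
  refine ⟨σ, ?_⟩
  by_cases hd4 : 4 ≤ d
  swap
  · exact hQ.isBraxtope_facet_of_card hd hB (by omega) σ hσ
  have hF := hQ.isFacet hd hB
  set P := convexHull ℝ (x '' indexE d n j) with hP
  have hVA : IsVertexArray P (x ∘ σ) := hQ.1.face hF.1 σ σ.injective fun i => by
    rw [hσ, hP, hQ.1.mem_hull_iff]
  -- Prospective facets of `E_j` are intersections of `E_j` with facets.
  have hinter : ∀ L : Set (Fin (m + 1)), IsFacetIndex (d - 1) m L →
      ∃ B, IsFacetIndex d n B ∧ ∀ t, t ∈ L ↔ σ t ∈ B := by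
    rintro L (⟨i, hi, rfl⟩ | ⟨k, h2, hk, rfl⟩)
    · rcases exists_inT_iff_facetPos hd4 hj hjn hs hm hi with ⟨i', hi', h⟩ | ⟨j', h2', hj', h⟩
      · exact ⟨_, Or.inl ⟨i', hi', rfl⟩, fun t => h t (Nat.le_of_lt_succ t.2)⟩
      · exact ⟨_, Or.inr ⟨j', h2', hj', rfl⟩, fun t => h t (Nat.le_of_lt_succ t.2)⟩
    · obtain ⟨j', h2', hj', h⟩ := exists_inE_iff_facetPos hd4 hj hjn hs hm h2 hk
      exact ⟨_, Or.inr ⟨j', h2', hj', rfl⟩, fun t => h t (Nat.le_of_lt_succ t.2)⟩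
  have himg : ∀ L : Set (Fin (m + 1)), (x ∘ σ) '' L = x '' (σ '' L) := fun L =>
    Set.image_comp x σ L
  have hmn : d - 1 ≤ m := by omega
  refine isBraxtope_of_isFacet_iff hVA ?_ (by omega) hmn fun F =>
    hVA.isFacet_iff_of_cover ?_ ?_ ?_ ?_ ?_
  · rw [hF.2, hQ.2.1]
    omega
  · intro L hL
    obtain ⟨B, hB', hLB⟩ := hinter L hL
    have hsub : σ '' L ⊆ indexE d n j := by
      rintro _ ⟨t, -, rfl⟩
      exact (hσ _).1 ⟨t, rfl⟩
    rw [himg]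
    refine IsExposed.mono (hQ.isFace_hull hd fun i hi => ?_) (hQ.1.hull_subset _)
      (convexHull_mono (Set.image_mono hsub))
    by_cases hiE : i ∈ indexE d n j
    · obtain ⟨t, rfl⟩ := (hσ i).2 hiE
      refine ⟨B, hB', ?_, fun h => hi ⟨t, (hLB t).2 h, rfl⟩⟩
      rintro _ ⟨t', ht', rfl⟩
      exact (hLB t').1 ht'
    · exact ⟨_, hB, hsub, hiE⟩
  · rintro L (⟨i, hi, rfl⟩ | ⟨k, h2, hk, rfl⟩)
    · exact ⟨⟨i, by omega⟩, mem_indexT.2 ⟨le_rfl, by simp only; omega⟩⟩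
    · exact ⟨0, mem_indexE.2 (Or.inl rfl)⟩
  · rintro L hL rfl
    have h0 : ∀ t (ht : t ≤ m), (⟨t, Nat.lt_succ_of_le ht⟩ : Fin (m + 1)) ∈
      (Set.univ : Set (Fin (m + 1))) := fun t ht => Set.mem_univ _
    rcases hL with ⟨i, hi, h⟩ | ⟨k, h2, hk, h⟩
    · rw [h] at h0
      simp only [mem_indexT] at h0
      have := h0 0 (by omega)
      have := h0 m le_rfl
      omega
    · rw [h] at h0
      simp only [mem_indexE] at h0
      have := h0 k hk
      have := h0 1 (by omega)
      omega
  · intro G hG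
    have hGn : G.Nonempty := by
      rw [Set.nonempty_iff_ne_empty]
      rintro rfl
      have h1 := hG.2
      rw [pdim_empty, hF.2, hQ.2.1] at h1
      omega
    have hGF := hQ.1.isFace_trans hF.1 hG.1
    obtain ⟨i, hi⟩ : ∃ i, (x ∘ σ) i ∉ G := by
      by_contra! hcon
      refine hG.ne ((IsExposed.subset hG.1).antisymm ?_)
      exact hVA.face_subset (IsFace.self _) hG.1 fun i _ => hcon i
    obtain ⟨B, hB', hGB, hiB⟩ := hQ.exists_facetIndex hd hGF hGn hi
    suffices hL : ∃ L, IsFacetIndex (d - 1) m L ∧ ∀ t, σ t ∈ B → t ∈ L by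
      obtain ⟨L, hL, h⟩ := hL
      refine ⟨L, hL, ?_⟩
      rw [hVA.face_eq_hull hG.1]
      exact convexHull_mono (Set.image_mono fun t ht => h t (hGB _ ht))
    rcases hB' with ⟨i', hi', rfl⟩ | ⟨j', h2', hj', rfl⟩
    · obtain ⟨k, hk, h⟩ := exists_cover_of_inT hd4 hj hjn hs hm hi'
      exact ⟨_, Or.inl ⟨k, hk, rfl⟩, fun t => h t (Nat.le_of_lt_succ t.2)⟩
    · have hne : j ≠ j' := by
        rintro rfl
        exact hiB ((hσ _).1 ⟨i, rfl⟩)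
      rcases exists_cover_of_inE hd4 hj hjn hs hm h2' hj' hne with h | ⟨k, hk2, hkm, h⟩
      · exact ⟨_, Or.inl ⟨0, by omega, rfl⟩, fun t ht => mem_indexT.2 ⟨Nat.zero_le _, by
          have := h t (Nat.le_of_lt_succ t.2) ht
          omega⟩⟩
      · exact ⟨_, Or.inr ⟨k, hk2, hkm, rfl⟩, fun t => h t (Nat.le_of_lt_succ t.2)⟩
  · intro L L' hL hL' h
    exact isFacetIndex_antichain (by omega) hmn hL hL' h

theorem IsBraxtope.exists_isBraxtope_facet [FiniteDimensional ℝ E] (hQ : IsBraxtope d x Q)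
    (hd : 3 ≤ d) (hF : IsFacet Q F) :
    ∃ (m : ℕ) (σ : Fin (m + 1) ↪o Fin (n + 1)), IsBraxtope (d - 1) (x ∘ σ) F := by
  have hn := (hQ.2.2.2 hd).1
  obtain ⟨B, hB, rfl⟩ := (hQ.isFacet_iff hd).1 hF
  rcases id hB with ⟨i, hi, rfl⟩ | ⟨j, h2, hj, rfl⟩
  · let σ : Fin (d - 1 + 1) ↪o Fin (n + 1) := OrderEmbedding.ofStrictMono
      (fun t => ⟨t + i, by omega⟩) fun a b hab => by
        rw [Fin.lt_def] at hab ⊢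
        simpa using hab
    refine ⟨d - 1, σ, hQ.isBraxtope_facet_of_card hd hB (by omega) σ fun k => ?_⟩
    rw [mem_indexT]
    constructor
    · rintro ⟨t, rfl⟩
      change i ≤ (t : ℕ) + i ∧ (t : ℕ) + i < i + d
      omega
    · rintro ⟨h1, h2⟩
      exact ⟨⟨k - i, by omega⟩, Fin.ext (Nat.sub_add_cancel h1)⟩
  · rcases hj.lt_or_eq with hjn | rfl
    · exact ⟨_, hQ.facetE hd h2 hjn rfl⟩
    let σ : Fin (d - 1 + 1) ↪o Fin (j + 1) := OrderEmbedding.ofStrictMono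
      (fun t => ⟨if (t : ℕ) = 0 then 0 else t + (j + 1 - d), by split_ifs <;> omega⟩)
      fun a b hab => by
        rw [Fin.lt_def] at hab ⊢
        simp only
        split_ifs <;> omega
    have hσ : ∀ t, (σ t : ℕ) = if (t : ℕ) = 0 then 0 else t + (j + 1 - d) := fun t => rfl
    refine ⟨d - 1, σ, hQ.isBraxtope_facet_of_card hd hB (by omega) σ fun k => ?_⟩
    rw [mem_indexE]
    constructor
    · rintro ⟨t, rfl⟩
      rw [hσ]
      split_ifs <;> omega
    · intro h
      refine ⟨⟨k - (j + 1 - d), by omega⟩, Fin.ext ?_⟩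
      rw [hσ]
      simp only
      split_ifs <;> omega

/-- Every nonempty face of a braxtope is a braxtope with the induced vertex array. -/
theorem IsBraxtope.exists_isBraxtope_face [FiniteDimensional ℝ E] (hQ : IsBraxtope d x Q)
    (hF : IsFace Q F) (hFn : F.Nonempty) :
    ∃ (k m : ℕ) (σ : Fin (m + 1) ↪o Fin (n + 1)), IsBraxtope k (x ∘ σ) F := by
  induction d using Nat.strong_induction_on generalizing n x Q with
  | _ d ih =>
    by_cases hd : 3 ≤ d
    · by_cases hFQ : F = Q
      · exact ⟨d, n, RelEmbedding.refl _, hFQ ▸ hQ⟩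
      obtain ⟨G, hG, hFG⟩ := hQ.1.exists_facet_of_ne hF hFn hFQ
      obtain ⟨m, σ, hσ⟩ := hQ.exists_isBraxtope_facet hd hG
      obtain ⟨k, m', τ, hτ⟩ := ih (d - 1) (by omega) hσ
        (IsExposed.mono hF (IsExposed.subset hG.1) hFG)
      exact ⟨k, m', τ.trans σ, hτ⟩
    · obtain ⟨rfl, -⟩ := hQ.2.2.1 (by omega)
      obtain ⟨m, σ, h⟩ := exists_isBraxtope_of_simplex hQ.1 hQ.2.1 hF hFn
      exact ⟨m, m, σ, h⟩

theorem IsBraxtope.isBraxial [FiniteDimensional ℝ E] (hQ : IsBraxtope d x Q) :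
    IsBraxial d x Q :=
  ⟨hQ.1, hQ.2.1, fun _ hF hFn _ => hQ.exists_isBraxtope_face hF hFn⟩

/-! ### Multifold pyramids -/

theorem convexHull_insert_hull (v : E) (S : Set E) :
    convexHull ℝ (insert v (convexHull ℝ S)) = convexHull ℝ (insert v S) :=
  (convexHull_min (Set.insert_subset (subset_convexHull ℝ _ (Set.mem_insert _ _))
    (convexHull_mono (Set.subset_insert _ _))) (convex_convexHull ℝ _)).antisymm
    (convexHull_mono (Set.insert_subset_insert (subset_convexHull ℝ S)))

/-- If `n ≤ 2d - 3` then `E_{d-1}` contains all vertices but `x_{d-1}`, so the braxtope is a pyramid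
over it; the base is again a braxtope, with both parameters lowered by one. -/
theorem IsBraxtope.exists_isFoldPyramid [FiniteDimensional ℝ E] (hQ : IsBraxtope d x Q)
    (hd : 2 ≤ d) (hn : n + 2 ≤ 2 * d) :
    ∃ (B : Set E) (m : ℕ) (σ : Fin (m + 1) ↪o Fin (n + 1)),
      IsBraxtope (n - d + 2) (x ∘ σ) B ∧ IsFoldPyramid (2 * d - 2 - n) Q B := by
  induction d, hd using Nat.le_induction generalizing n x Q with
  | base =>
    obtain ⟨rfl, -⟩ := hQ.2.2.1 le_rfl
    exact ⟨Q, 2, RelEmbedding.refl _, hQ, rfl⟩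
  | succ d hd ih =>
    have hdn := (hQ.2.2.2 (by omega)).1
    by_cases hnd : n = 2 * d
    · subst hnd
      refine ⟨Q, _, RelEmbedding.refl _, ?_, ?_⟩
      · rw [show 2 * d - (d + 1) + 2 = d + 1 by omega]
        exact hQ
      · rw [show 2 * (d + 1) - 2 - 2 * d = 0 by omega]
        rfl
    obtain ⟨σ, hσ⟩ := hQ.facetE (m := n - 1) (by omega) hd (by omega) (by omega)
    obtain ⟨B, m, τ, hτ, hB⟩ := ih hσ (by omega)
    refine ⟨B, m, τ.trans σ, ?_, ?_⟩
    · rw [show n - (d + 1) + 2 = n - 1 - d + 2 by omega]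
      exact hτ
    rw [show 2 * (d + 1) - 2 - n = (2 * d - 2 - (n - 1)) + 1 by omega]
    have hj : d < n + 1 := by omega
    refine ⟨_, hB, x ⟨d, hj⟩, ?_, ?_⟩
    · intro h
      have hE : IsFacetIndex (d + 1) n (indexE (d + 1) n d) := Or.inr ⟨d, hd, by omega, rfl⟩
      have := (hQ.isFace (by omega) hE).mem_of_mem_affineSpan (hQ.1.mem _) h
      have := mem_indexE.1 (hQ.1.mem_hull_iff.1 this)
      simp only at this
      omega
    · rw [convexHull_insert_hull, ← Set.image_insert_eq, hQ.1.eq_convexHull,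
        ← Set.image_univ]
      congr 2
      symm
      rw [Set.eq_univ_iff_forall]
      intro t
      by_cases ht : (t : ℕ) = d
      · exact Or.inl (Fin.ext ht)
      · right
        rw [mem_indexE]
        omega

end

section

variable {E : Type*} [NormedAddCommGroup E] [NormedSpace ℝ E]
variable {d n : ℕ} {x : Fin (n + 1) → E} {P Q F G : Set E}

/-! ### Flags of vertices and two-dimensional faces -/

theorem IsVertexArray.faces_pdim_zero [FiniteDimensional ℝ E] (h : IsVertexArray P x) :
    IsFace P F ∧ pdim F = 0 ↔ ∃ i, F = {x i} := by
  have hs : ∀ i, pdim {x i} = 0 := fun i => by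
    rw [pdim_of_nonempty (Set.singleton_nonempty _), vectorSpan_singleton, finrank_bot]
    rfl
  constructor
  · rintro ⟨hF, h0⟩
    have hn : F.Nonempty := by
      rw [Set.nonempty_iff_ne_empty]
      rintro rfl
      rw [pdim_empty] at h0
      omega
    obtain ⟨i, hi⟩ := h.exists_mem_face hF hn
    exact ⟨i, ((h.isFace_singleton i).eq_of_pdim_le (IsExposed.subset hF)
      (Set.singleton_subset_iff.2 hi) (by rw [hs, h0])).symm⟩
  · rintro ⟨i, rfl⟩
    exact ⟨h.isFace_singleton i, hs i⟩

/-- Since all two-dimensional faces are triangles, each of them has three vertices. -/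
theorem IsBraxtope.flagCount_zero_two [FiniteDimensional ℝ E] (hQ : IsBraxtope d x Q) :
    flagCount Q 0 2 = 3 * faceCount Q 2 := by
  have htri : ∀ G, IsFace Q G ∧ pdim G = 2 → ∃ y : Fin 3 → E, IsVertexArray G y := by
    rintro G ⟨hG, h2⟩
    have hn : G.Nonempty := by
      rw [Set.nonempty_iff_ne_empty]
      rintro rfl
      rw [pdim_empty] at h2
      omega
    obtain ⟨k, m, σ, hσ⟩ := hQ.exists_isBraxtope_face hG hn
    have hk := hσ.2.1
    obtain rfl : k = 2 := by omega
    obtain ⟨rfl, -⟩ := hσ.2.2.1 le_rfl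
    exact ⟨_, hσ.1⟩
  choose! y hy using htri
  have he : {p : Set E × Set E | IsFace Q p.1 ∧ IsFace Q p.2 ∧ p.1 ⊆ p.2 ∧
      pdim p.1 = 0 ∧ pdim p.2 = 2} =
      (fun q : Set E × Fin 3 => (({y q.1 q.2} : Set E), q.1)) ''
        ({G | IsFace Q G ∧ pdim G = 2} ×ˢ (Set.univ : Set (Fin 3))) := by
    ext ⟨F, G⟩
    constructor
    · rintro ⟨hF, hG, hFG, h0, h2⟩
      obtain ⟨i, hi⟩ := (hy G ⟨hG, h2⟩).faces_pdim_zero.1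
        ⟨IsExposed.mono hF (IsExposed.subset hG) hFG, h0⟩
      exact ⟨(G, i), ⟨⟨hG, h2⟩, Set.mem_univ _⟩, Prod.ext hi.symm rfl⟩
    · rintro ⟨⟨G', i⟩, ⟨hG, -⟩, he⟩
      obtain ⟨rfl, rfl⟩ := Prod.ext_iff.1 he
      have h1 := (hy G' hG).faces_pdim_zero.2 ⟨i, rfl⟩
      exact ⟨hQ.1.isFace_trans hG.1 h1.1, hG.1, IsExposed.subset h1.1, h1.2, hG.2⟩
  rw [flagCount, he, Set.InjOn.ncard_image, Set.ncard_prod, Set.ncard_univ, Nat.card_fin, mul_comm]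
  · rfl
  · rintro ⟨G, i⟩ ⟨hG, -⟩ ⟨G', i'⟩ - h
    obtain ⟨h1, rfl⟩ := Prod.ext_iff.1 h
    have := (hy G hG).injective (Set.singleton_injective h1)
    exact Prod.ext rfl this

theorem IsBraxtope.isElementary [FiniteDimensional ℝ E] (hQ : IsBraxtope d x Q) (hd : 3 ≤ d) :
    IsElementary d Q := by
  have hn := (hQ.2.2.2 hd).1
  rw [IsElementary, hQ.flagCount_zero_two, hQ.faceCount_binom hd 1 (by norm_num),
    hQ.faceCount_binom hd 0 (by norm_num)]
  obtain ⟨e, rfl⟩ := Nat.exists_eq_add_of_le hn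
  have hb : ∀ a b : ℕ, binom a (b : ℤ) = a.choose b := fun a b => by
    rw [binom, if_neg (by omega), Int.toNat_natCast]
  have h1 : binom (d + 1) (1 + 1) = (d + 1).choose 2 := hb _ 2
  have h2 : binom (d - 1) 1 = d - 1 := (hb _ 1).trans (Nat.choose_one_right _)
  have h3 : binom (d - 2) (1 - 1) = 1 := (hb _ 0).trans (Nat.choose_zero_right _)
  have h4 : binom (d + 1) (0 + 1) = d + 1 := (hb _ 1).trans (Nat.choose_one_right _)
  have h5 : binom (d - 1) 0 = 1 := (hb _ 0).trans (Nat.choose_zero_right _)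
  have h6 : binom (d - 2) (0 - 1) = 0 := if_pos (by norm_num)
  have h7 : (((d + 1).choose 2 : ℕ) : ℤ) * 2 = (d + 1) * d := by
    have := Nat.add_one_mul_choose_eq d 1
    rw [Nat.choose_one_right] at this
    exact_mod_cast this.symm
  rw [h1, h2, h3, h4, h5, h6, show d + e - d = e by omega, show d - 1 + 1 = d by omega]
  push_cast
  linarith

/-! ### Vertex figures -/

/-- The point in which the line through `v` and `w` meets the hyperplane `l = c`. -/
noncomputable def cutPoint (l : E →L[ℝ] ℝ) (c : ℝ) (v w : E) : E :=
  AffineMap.lineMap v w ((c - l v) / (l w - l v))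

variable {l : E →L[ℝ] ℝ} {c : ℝ} {v w : E} {T : Set E}

theorem apply_cutPoint (hv : l v < c) (hw : c < l w) : l (cutPoint l c v w) = c := by
  have h : l w - l v ≠ 0 := by linarith
  rw [cutPoint, AffineMap.lineMap_apply]
  simp only [vsub_eq_sub, vadd_eq_add, map_add, map_smul, map_sub, smul_eq_mul]
  rw [div_mul_cancel₀ _ h]
  ring

theorem cutPoint_mem_segment (hv : l v < c) (hw : c < l w) : cutPoint l c v w ∈ segment ℝ v w := by
  rw [segment_eq_image_lineMap]
  exact ⟨_, ⟨div_nonneg (by linarith) (by linarith), (div_le_one (by linarith)).2 (by linarith)⟩,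
    rfl⟩

theorem sub_eq_smul_cutPoint_sub (hv : l v < c) (hw : c < l w) :
    w - v = ((l w - l v) / (c - l v)) • (cutPoint l c v w - v) := by
  have h1 : l w - l v ≠ 0 := by linarith
  have h2 : c - l v ≠ 0 := by linarith
  rw [cutPoint, AffineMap.lineMap_apply, vsub_eq_sub, vadd_eq_add, add_sub_cancel_right, smul_smul,
    div_mul_div_cancel₀ h2, div_self h1, one_smul]

/-- The convex cone with apex `v` over a convex set. -/
theorem convex_cone {C : Set E} (hC : Convex ℝ C) (hne : C.Nonempty) :
    Convex ℝ {q : E | ∃ r : ℝ, 0 ≤ r ∧ ∃ p ∈ C, q - v = r • (p - v)} := by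
  rintro q₁ ⟨r₁, hr₁, p₁, hp₁, h₁⟩ q₂ ⟨r₂, hr₂, p₂, hp₂, h₂⟩ a b ha hb hab
  have hcomb : a • q₁ + b • q₂ - v = (a * r₁) • (p₁ - v) + (b * r₂) • (p₂ - v) := by
    rw [mul_smul, mul_smul, ← h₁, ← h₂]
    have : v = a • v + b • v := by rw [← add_smul, hab, one_smul]
    nth_rewrite 1 [this]
    rw [smul_sub, smul_sub]
    abel
  have hR₁ : 0 ≤ a * r₁ := mul_nonneg ha hr₁
  have hR₂ : 0 ≤ b * r₂ := mul_nonneg hb hr₂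
  rcases (add_nonneg hR₁ hR₂).eq_or_lt with hR | hR
  · obtain ⟨p, hp⟩ := hne
    refine ⟨0, le_rfl, p, hp, ?_⟩
    rw [hcomb, show a * r₁ = 0 by linarith, show b * r₂ = 0 by linarith]
    simp
  · refine ⟨a * r₁ + b * r₂, hR.le, (a * r₁ / (a * r₁ + b * r₂)) • p₁ +
      (b * r₂ / (a * r₁ + b * r₂)) • p₂, hC hp₁ hp₂ (by positivity) (by positivity)
      (by rw [← add_div, div_self hR.ne']), ?_⟩
    rw [hcomb, smul_sub (a * r₁ + b * r₂), smul_add, smul_smul, smul_smul,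
      mul_div_cancel₀ _ hR.ne', mul_div_cancel₀ _ hR.ne', smul_sub, smul_sub, add_smul]
    abel

/-- The section of a convex hull by a hyperplane that separates the vertex `v` from the other
generators. -/
theorem hull_inter_hyperplane (hT : T.Nonempty) (hv : l v < c) (hw : ∀ w ∈ T, c < l w) :
    convexHull ℝ (insert v T) ∩ {p | l p = c} = convexHull ℝ (cutPoint l c v '' T) := by
  have hC : ∀ p ∈ convexHull ℝ (cutPoint l c v '' T), l p = c := by
    intro p hp
    refine convexHull_min ?_ (convex_hyperplane l.isLinear c) hp
    rintro _ ⟨w, hwT, rfl⟩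
    exact apply_cutPoint hv (hw w hwT)
  refine Set.Subset.antisymm ?_ fun p hp => ⟨?_, hC p hp⟩
  · rintro p ⟨hp, hpc⟩
    have hne := (hT.image (cutPoint l c v)).convexHull (𝕜 := ℝ)
    have hsub : insert v T ⊆ {q : E | ∃ r : ℝ, 0 ≤ r ∧
        ∃ p ∈ convexHull ℝ (cutPoint l c v '' T), q - v = r • (p - v)} := by
      rintro q (rfl | hq)
      · obtain ⟨p, hp⟩ := hne
        exact ⟨0, le_rfl, p, hp, by simp⟩
      · have := hw q hq
        exact ⟨_, div_nonneg (by linarith) (by linarith), _,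
          subset_convexHull ℝ _ ⟨q, hq, rfl⟩, sub_eq_smul_cutPoint_sub hv this⟩
    obtain ⟨r, -, q, hq, h⟩ := convexHull_min hsub (convex_cone (convex_convexHull ℝ _) hne) hp
    have h1 := congrArg l h
    rw [map_sub, map_smul, map_sub, hC q hq, show l p = c from hpc, smul_eq_mul] at h1
    have hr : r = 1 := by
      have h2 : c - l v ≠ 0 := by linarith
      have h3 : (r - 1) * (c - l v) = 0 := by linarith
      have := (mul_eq_zero.1 h3).resolve_right h2
      linarith
    rw [hr, one_smul, sub_left_inj] at h
    rwa [h]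
  · refine convexHull_min ?_ (convex_convexHull ℝ _) hp
    rintro _ ⟨w, hwT, rfl⟩
    exact segment_subset_convexHull (Set.mem_insert _ _) (Set.mem_insert_of_mem _ hwT)
      (cutPoint_mem_segment hv (hw w hwT))

theorem pdim_le_of_subset_affineSpan [FiniteDimensional ℝ E] {S T : Set E} (hS : S.Nonempty)
    (h : S ⊆ affineSpan ℝ T) : pdim S ≤ pdim T := by
  have hT : T.Nonempty := (affineSpan_nonempty ℝ).1 (hS.mono h)
  rw [pdim_of_nonempty hS, pdim_of_nonempty hT, ← direction_affineSpan, ← direction_affineSpan]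
  exact_mod_cast Submodule.finrank_mono (AffineSubspace.direction_le (affineSpan_le.2 h))

theorem mem_affineSpan_cutPoint (hv : l v < c) (hw : c < l w) :
    w ∈ affineSpan ℝ {v, cutPoint l c v w} := by
  have h := AffineMap.lineMap_mem_affineSpan_pair ((l w - l v) / (c - l v)) v (cutPoint l c v w)
  rwa [AffineMap.lineMap_apply, vsub_eq_sub, vadd_eq_add, ← sub_eq_smul_cutPoint_sub hv hw,
    sub_add_cancel] at h

theorem pdim_hull_inter_hyperplane [FiniteDimensional ℝ E] (hT : T.Nonempty) (hv : l v < c)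
    (hw : ∀ w ∈ T, c < l w) : pdim (convexHull ℝ (insert v T) ∩ {p | l p = c}) =
      pdim (convexHull ℝ (insert v T)) - 1 := by
  rw [hull_inter_hyperplane hT hv hw, pdim_convexHull, pdim_convexHull]
  have h1 : v ∉ affineSpan ℝ (cutPoint l c v '' T) := fun h => by
    have := apply_eq_of_mem_affineSpan l (M := c) (by
      rintro _ ⟨w, hwT, rfl⟩
      exact apply_cutPoint hv (hw w hwT)) h
    linarith
  have h2 : pdim (insert v T) = pdim (insert v (cutPoint l c v '' T)) := by
    refine le_antisymm (pdim_le_of_subset_affineSpan (Set.insert_nonempty _ _) ?_)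
      (pdim_le_of_subset_affineSpan (Set.insert_nonempty _ _) ?_)
    · rintro p (rfl | hp)
      · exact subset_affineSpan ℝ _ (Set.mem_insert _ _)
      · refine affineSpan_mono ℝ ?_ (mem_affineSpan_cutPoint hv (hw p hp))
        rintro _ (rfl | rfl)
        · exact Set.mem_insert _ _
        · exact Set.mem_insert_of_mem _ ⟨p, hp, rfl⟩
    · rintro p (rfl | ⟨w, hwT, rfl⟩)
      · exact subset_affineSpan ℝ _ (Set.mem_insert _ _)
      · refine affineSpan_mono ℝ ?_ (AffineMap.lineMap_mem_affineSpan_pair _ v w)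
        rintro _ (rfl | rfl)
        · exact Set.mem_insert _ _
        · exact Set.mem_insert_of_mem _ hwT
  rw [h2, pdim_insert_of_notMem h1]
  ring

theorem IsFace.inter_hyperplane (hF : IsFace P F) (hn : F.Nonempty) (l : E →L[ℝ] ℝ) (c : ℝ) :
    IsFace (P ∩ {p | l p = c}) (F ∩ {p | l p = c}) := by
  obtain ⟨g, M, hg, hFe⟩ := hF.exists_functional hn
  have : F ∩ {p | l p = c} = {p ∈ P ∩ {p | l p = c} | g p = M} := by
    rw [hFe]
    ext p
    exact ⟨fun h => ⟨⟨h.1.1, h.2⟩, h.1.2⟩, fun h => ⟨⟨h.1.1, h.2⟩, h.1.2⟩⟩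
  rw [this]
  exact isFace_of_functional g M fun p hp => hg p hp.1

/-- Every nonempty face of a vertex figure at `x_0` is the section of a face containing `x_0`: tilt
a supporting hyperplane of the section until it passes through `x_0`. -/
theorem IsVertexArray.exists_face_of_section (h : IsVertexArray P x) (hv : l (x 0) < c)
    (hw : ∀ i, i ≠ 0 → c < l (x i)) (hG : IsFace (P ∩ {p | l p = c}) G) (hGn : G.Nonempty) :
    ∃ F, IsFace P F ∧ x 0 ∈ F ∧ G = F ∩ {p | l p = c} := by
  obtain ⟨g, M, hg, hGe⟩ := hG.exists_functional hGn
  set κ := (g (x 0) - M) / (l (x 0) - c) with hκ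
  have hκ' : κ * (l (x 0) - c) = g (x 0) - M := div_mul_cancel₀ _ (by linarith)
  have hb : ∀ i, (g - κ • l) (x i) ≤ M - κ * c := by
    intro i
    change g (x i) - κ * l (x i) ≤ _
    by_cases hi : i = 0
    · rw [hi]
      linarith
    have hli := hw i hi
    have hP : Convex ℝ P := h.eq_convexHull ▸ convex_convexHull ℝ _
    have hz := hg (cutPoint l c (x 0) (x i)) ⟨hP.segment_subset (h.mem 0) (h.mem i)
      (cutPoint_mem_segment hv hli), apply_cutPoint hv hli⟩
    have hlz := apply_cutPoint hv hli
    have hsub := congrArg g (sub_eq_smul_cutPoint_sub hv hli)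
    rw [map_sub, map_smul, map_sub, smul_eq_mul] at hsub
    have hr : 0 < (l (x i) - l (x 0)) / (c - l (x 0)) := div_pos (by linarith) (by linarith)
    have hr' : (l (x i) - l (x 0)) / (c - l (x 0)) * (c - l (x 0)) = l (x i) - l (x 0) :=
      div_mul_cancel₀ _ (by linarith)
    have := mul_le_mul_of_nonneg_left hz hr.le
    have h5 : κ * (l (x i) - l (x 0)) = ((l (x i) - l (x 0)) / (c - l (x 0))) *
        (κ * (c - l (x 0))) := by rw [mul_left_comm, hr']
    have h6 : κ * (c - l (x 0)) = M - g (x 0) := by linarith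
    rw [h6] at h5
    linarith
  refine ⟨_, h.isFace_of_vertices _ _ hb, ⟨h.mem 0, ?_⟩, ?_⟩
  · change g (x 0) - κ * l (x 0) = _
    linarith
  · rw [hGe]
    ext p
    constructor
    · rintro ⟨⟨hp, hpc⟩, hgp⟩
      refine ⟨⟨hp, ?_⟩, hpc⟩
      change g p - κ * l p = _
      rw [hgp, show l p = c from hpc]
    · rintro ⟨⟨hp, hgp⟩, hpc⟩
      refine ⟨⟨hp, hpc⟩, ?_⟩
      change g p - κ * l p = _ at hgp
      rw [show l p = c from hpc] at hgp
      linarith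

theorem image_eq_insert {X : Type*} {x : Fin (n + 1) → X} {A : Set (Fin (n + 1))} (h0 : 0 ∈ A) :
    x '' A = insert (x 0) (x '' (A \ {0})) := by
  rw [← Set.image_insert_eq, Set.insert_sdiff_singleton, Set.insert_eq_of_mem h0]

theorem pdim_inter_hyperplane [FiniteDimensional ℝ E] (hv : l (x 0) < c)
    (hw : ∀ i, i ≠ 0 → c < l (x i)) {A : Set (Fin (n + 1))} (h0 : 0 ∈ A) {i : Fin (n + 1)}
    (hi : i ∈ A) (hi0 : i ≠ 0) : pdim (convexHull ℝ (x '' A) ∩ {p | l p = c}) =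
      pdim (convexHull ℝ (x '' A)) - 1 := by
  rw [image_eq_insert h0]
  refine pdim_hull_inter_hyperplane ⟨x i, i, ⟨hi, hi0⟩, rfl⟩ hv ?_
  rintro _ ⟨k, hk, rfl⟩
  exact hw k hk.2

theorem IsVertexArray.isFacet_section_iff [FiniteDimensional ℝ E] (h : IsVertexArray P x)
    (hP : 2 ≤ pdim P) (hv : l (x 0) < c) (hw : ∀ i, i ≠ 0 → c < l (x i)) :
    IsFacet (P ∩ {p | l p = c}) G ↔ ∃ F, IsFacet P F ∧ x 0 ∈ F ∧ G = F ∩ {p | l p = c} := by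
  have hdim : ∀ F, IsFace P F → x 0 ∈ F → (∃ i, i ≠ 0 ∧ x i ∈ F) →
      pdim (F ∩ {p | l p = c}) = pdim F - 1 := by
    rintro F hF h0 ⟨i, hi0, hi⟩
    rw [h.face_eq_hull hF]
    exact pdim_inter_hyperplane hv hw (A := {i | x i ∈ F}) h0 hi hi0
  have hex : ∀ F, IsFace P F → x 0 ∈ F → 1 ≤ pdim F → ∃ i, i ≠ 0 ∧ x i ∈ F := by
    intro F hF h0 h1
    by_contra! hcon
    have : F ⊆ {x 0} := h.face_subset hF (h.isFace_singleton 0) fun i hi => by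
      by_cases hi0 : i = 0
      · rw [hi0]; rfl
      · exact absurd hi (hcon i hi0)
    have h2 := pdim_mono this
    have := (h.faces_pdim_zero.2 ⟨0, rfl⟩).2
    omega
  have hPs : pdim (P ∩ {p | l p = c}) = pdim P - 1 :=
    hdim P (IsFace.self P) (h.mem 0) (hex P (IsFace.self P) (h.mem 0) (by omega))
  constructor
  · intro hG
    have hGn : G.Nonempty := by
      rw [Set.nonempty_iff_ne_empty]
      rintro rfl
      have := hG.2
      rw [pdim_empty] at this
      omega
    obtain ⟨F, hF, h0, rfl⟩ := h.exists_face_of_section hv hw hG.1 hGn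
    have hiF : ∃ i, i ≠ 0 ∧ x i ∈ F := by
      by_contra! hcon
      have hsub : F ⊆ {x 0} := h.face_subset hF (h.isFace_singleton 0) fun i hi => by
        by_cases hi0 : i = 0
        · rw [hi0]; rfl
        · exact absurd hi (hcon i hi0)
      obtain ⟨p, hp, hpc⟩ := hGn
      have h1 : p = x 0 := hsub hp
      have h2 : l p = c := hpc
      rw [h1] at h2
      linarith
    refine ⟨F, ⟨hF, ?_⟩, h0, rfl⟩
    have h1 := hdim F hF h0 hiF
    have h2 := hG.2
    omega
  · rintro ⟨F, hF, h0, rfl⟩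
    have := hF.2
    refine ⟨hF.1.inter_hyperplane ⟨_, h0⟩ l c, ?_⟩
    rw [hdim F hF.1 h0 (hex F hF.1 h0 (by omega)), hPs]
    omega

/-- The segments joining `x_0` to the other vertices are edges. -/
theorem IsBraxtope.isFace_edge (hQ : IsBraxtope d x Q) (hd : 3 ≤ d) (u : Fin (n + 1)) :
    IsFace Q (convexHull ℝ (x '' {0, u})) := by
  have hn := (hQ.2.2.2 hd).1
  have hu := u.2
  have hadm : IsAdmissible d n {0, (u : ℕ)} := by
    refine ⟨?_, ?_, ?_⟩ <;> simp only [Set.mem_insert_iff, Set.mem_singleton_iff] <;> omega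
  have hcl := hadm.isClosedIndex hd hn (by
    simp only [Set.mem_insert_iff, Set.mem_singleton_iff]; omega)
  convert hQ.isFace_of_isClosedIndex hd hcl using 4
  ext i
  simp only [Set.mem_insert_iff, Set.mem_singleton_iff, Set.mem_ofPred_eq, Fin.ext_iff,
    Fin.val_zero]

theorem IsVertexArray.exists_isVertexFigure (h : IsVertexArray P x) :
    ∃ S, IsVertexFigure P (x 0) S := by
  have h0 := h.isFace_singleton 0
  obtain ⟨g, M, hg, he⟩ := h0.exists_functional (Set.singleton_nonempty _)
  have h0M : g (x 0) = M := by
    have : x 0 ∈ ({x 0} : Set E) := rfl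
    rw [he] at this
    exact this.2
  have hlt : ∀ w ∈ vertices P, w ≠ x 0 → g w < M := fun w hw hne => by
    have hwP : w ∈ P := IsExposed.subset (show IsFace P {w} from hw) rfl
    refine lt_of_le_of_ne (hg w hwP) fun e => hne ?_
    have : w ∈ {p ∈ P | g p = M} := ⟨hwP, e⟩
    rw [← he] at this
    exact this
  have hfin : (vertices P \ {x 0}).Finite := by
    rw [h.vertices_eq]
    exact (Set.finite_range x).sdiff
  obtain ⟨K, hK, hK'⟩ : ∃ K < M, ∀ w ∈ vertices P, w ≠ x 0 → g w < K := by
    rcases (vertices P \ {x 0}).eq_empty_or_nonempty with hemp | hne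
    · exact ⟨M - 1, by linarith, fun w hw hw0 => absurd (show w ∈ vertices P \ {x 0} from
        ⟨hw, hw0⟩) (hemp ▸ Set.notMem_empty w)⟩
    · obtain ⟨w₀, hw₀, hmax⟩ := Set.exists_max_image _ g hfin hne
      have := hlt w₀ hw₀.1 hw₀.2
      exact ⟨(g w₀ + M) / 2, by linarith, fun w hw hw0 => by
        have := hmax w ⟨hw, hw0⟩
        linarith⟩
  refine ⟨_, h.vertices_eq ▸ ⟨0, rfl⟩, -g, -K, ?_, fun w hw hne => ?_, rfl⟩
  · change -g (x 0) < -K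
    linarith
  · have := hK' w hw hne
    change -K < -g w
    linarith

end

section

variable {E : Type*} [NormedAddCommGroup E] [NormedSpace ℝ E]
variable {d n : ℕ} {x : Fin (n + 1) → E} {P Q F G S : Set E}

/-- The `i`-th facet of the multiplex cut out at `x_0`, whose vertex `t` lies on `[x_0, x_{t + 1}]`:
it comes from `T_0` if `i = 0`, and from `E_{i + 1}` otherwise. -/
theorem multiplexFacet_eq {X : Type*} (y : Fin (n - 1 + 1) → X) (hd : 3 ≤ d) (hn : d ≤ n)
    {i : ℕ} (hi : i ≤ n - 1) {B : Set (Fin (n + 1))}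
    (hB : B = if i = 0 then indexT d n 0 else indexE d n (i + 1))
    (e : Fin (n - 1 + 1) → Fin (n + 1)) (he : ∀ t, (e t : ℕ) = t + 1) :
    vtx y '' {t : ℤ | (i : ℤ) - (d - 1 : ℕ) + 1 ≤ t ∧ t ≤ (i : ℤ) + (d - 1 : ℕ) - 1 ∧ t ≠ i} =
      y '' {t | e t ∈ B} := by
  have hmem : ∀ t, e t ∈ B ↔
      (i = 0 ∧ (t : ℕ) + 1 < d) ∨ (i ≠ 0 ∧ i + 2 ≤ t + d ∧ t + 2 ≤ i + d ∧
        ((t : ℕ) ≠ i ∨ (t : ℕ) + 1 = n)) := fun t => by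
    rw [hB]
    split_ifs with h0
    · rw [mem_indexT, he]; omega
    · rw [mem_indexE, he]; omega
  ext p
  constructor
  · rintro ⟨t, ⟨h1, h2, h3⟩, rfl⟩
    refine ⟨⟨min t.toNat (n - 1), by omega⟩, ?_, rfl⟩
    rw [Set.mem_ofPred_eq, hmem]
    simp only
    omega
  · rintro ⟨s, hs, rfl⟩
    rw [Set.mem_ofPred_eq, hmem] at hs
    have hsn := s.2
    -- The end vertices `i = 0` and `i = n - 1` are kept, being also the values at the
    -- indices `-1` and `n`.
    by_cases hsi : (s : ℕ) = i
    · by_cases h0 : i = 0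
      · exact ⟨-1, ⟨by omega, by omega, by omega⟩, vtx_eq_of_le y (by omega)⟩
      · exact ⟨(n : ℤ), ⟨by omega, by omega, by omega⟩, vtx_eq_of_le y (by omega)⟩
    · exact ⟨(s : ℕ), ⟨by omega, by omega, by omega⟩, vtx_eq_of_le y (by omega)⟩

/-- A vertex figure of a braxtope at `x_0` is a multiplex: its facets are the sections of the facets
through `x_0`, namely `T_0` and the `E_j`. -/
theorem IsBraxtope.isMultiplex_vertexFigure [FiniteDimensional ℝ E] (hQ : IsBraxtope d x Q)
    (hd : 3 ≤ d) (hS : IsVertexFigure Q (x 0) S) :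
    ∃ y : Fin ((n - 1) + 1) → E,
      (∀ i : Fin ((n - 1) + 1), y i ∈ segment ℝ (x 0) (vtx x ((i : ℕ) + 1)) ∩ S) ∧
      IsMultiplex (d - 1) y S := by
  have hn := (hQ.2.2.2 hd).1
  obtain ⟨-, l, c, hv, hw', rfl⟩ := hS
  have hw : ∀ i, i ≠ 0 → c < l (x i) := fun i hi =>
    hw' _ (hQ.1.vertices_eq ▸ ⟨i, rfl⟩) fun e => hi (hQ.1.injective e)
  let e : Fin (n - 1 + 1) → Fin (n + 1) := fun i => ⟨i + 1, by omega⟩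
  have hev : ∀ i, (e i : ℕ) = i + 1 := fun i => rfl
  have he0 : ∀ i, e i ≠ 0 := fun i h => by
    have := congrArg Fin.val h
    rw [hev, Fin.val_zero] at this
    omega
  have hesurj : ∀ i, i ≠ 0 → ∃ k, e k = i := fun i hi => by
    have hi' : (i : ℕ) ≠ 0 := fun h => hi (Fin.ext h)
    exact ⟨⟨i - 1, by omega⟩, Fin.ext (by rw [hev]; simp only; omega)⟩
  let y : Fin (n - 1 + 1) → E := fun i => cutPoint l c (x 0) (x (e i))
  have hyl : ∀ i, l (y i) = c := fun i => apply_cutPoint hv (hw _ (he0 i))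
  have hyseg : ∀ i, y i ∈ segment ℝ (x 0) (x (e i)) := fun i =>
    cutPoint_mem_segment hv (hw _ (he0 i))
  have hQc : Convex ℝ Q := hQ.1.eq_convexHull ▸ convex_convexHull ℝ _
  have hyQ : ∀ i, y i ∈ Q := fun i =>
    hQc.segment_subset (hQ.1.mem 0) (hQ.1.mem _) (hyseg i)
  have hsec : ∀ A : Set (Fin (n + 1)), 0 ∈ A → (∃ i ∈ A, i ≠ 0) →
      convexHull ℝ (x '' A) ∩ {p | l p = c} = convexHull ℝ (y '' {t | e t ∈ A}) := by
    rintro A h0 ⟨i, hi, hi0⟩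
    have hT : ∀ w ∈ x '' (A \ {0}), c < l w := by
      rintro _ ⟨k, hk, rfl⟩
      exact hw k hk.2
    rw [image_eq_insert h0,
      hull_inter_hyperplane (T := x '' (A \ {0})) ⟨x i, i, ⟨hi, hi0⟩, rfl⟩ hv hT]
    congr 1
    ext p
    constructor
    · rintro ⟨_, ⟨k, ⟨hk, hk0⟩, rfl⟩, rfl⟩
      obtain ⟨t, rfl⟩ := hesurj k hk0
      exact ⟨t, hk, rfl⟩
    · rintro ⟨t, ht, rfl⟩
      exact ⟨_, ⟨e t, ⟨ht, he0 t⟩, rfl⟩, rfl⟩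
  have hSeq : Q ∩ {p | l p = c} = convexHull ℝ (Set.range y) := by
    have := hsec Set.univ (Set.mem_univ _) ⟨e 0, Set.mem_univ _, he0 0⟩
    rw [Set.image_univ, ← hQ.1.eq_convexHull] at this
    rw [this]
    simp
  have hedge : ∀ i, convexHull ℝ (x '' {0, e i}) ∩ {p | l p = c} = {y i} := by
    intro i
    rw [hsec _ (Or.inl rfl) ⟨e i, Or.inr rfl, he0 i⟩]
    have : {t | e t ∈ ({0, e i} : Set (Fin (n + 1)))} = {i} := by
      ext t
      simp only [Set.mem_ofPred_eq, Set.mem_insert_iff, Set.mem_singleton_iff, Fin.ext_iff, hev,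
        Fin.val_zero]
      omega
    rw [this, Set.image_singleton, convexHull_singleton]
  have hVA : IsVertexArray (Q ∩ {p | l p = c}) y := by
    refine ⟨fun i k hik => ?_, Set.Subset.antisymm ?_ ?_, hSeq⟩
    · -- The line through `x_0` and the common point meets `Q` only in the edge `[x_0, x_i]`.
      have h1 := mem_affineSpan_cutPoint hv (hw _ (he0 k))
      have h2 : y k ∈ convexHull ℝ (x '' {0, e i}) := by
        have : y i ∈ convexHull ℝ (x '' {0, e i}) ∩ {p | l p = c} := by rw [hedge]; rfl
        exact hik ▸ this.1
      have h3 : x (e k) ∈ affineSpan ℝ (convexHull ℝ (x '' {0, e i})) := by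
        refine affineSpan_mono ℝ ?_ h1
        rintro _ (rfl | rfl)
        · exact subset_convexHull ℝ _ ⟨0, Or.inl rfl, rfl⟩
        · exact h2
      have h4 := hQ.1.mem_hull_iff.1 ((hQ.isFace_edge hd (e i)).mem_of_mem_affineSpan
        (hQ.1.mem _) h3)
      rcases h4 with h4 | h4
      · exact absurd h4 (he0 k)
      · have := congrArg Fin.val (show e k = e i from h4)
        rw [hev, hev] at this
        exact Fin.ext (by omega)
    · intro v hv'
      have h1 : v ∈ (Q ∩ {p | l p = c}).extremePoints ℝ := exposedPoints_subset_extremePoints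
        (mem_exposedPoints_iff_exposed_singleton.2 hv')
      rw [hSeq] at h1
      exact extremePoints_convexHull_subset h1
    · rintro _ ⟨i, rfl⟩
      have := (hQ.isFace_edge hd (e i)).inter_hyperplane
        ⟨x 0, subset_convexHull ℝ _ ⟨0, Or.inl rfl, rfl⟩⟩ l c
      rw [hedge] at this
      exact this
  refine ⟨y, fun i => ⟨?_, hyQ i, hyl i⟩, by omega, by omega, hVA, ?_, ?_⟩
  · rw [vtx_eq_of_le x (s := e i) (by rw [hev]; omega)]
    exact hyseg i
  · have := pdim_inter_hyperplane (x := x) hv hw (Set.mem_univ 0) (Set.mem_univ (e 0)) (he0 0)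
    rw [Set.image_univ, ← hQ.1.eq_convexHull, hQ.2.1] at this
    rw [this]
    omega
  ext G
  rw [Set.mem_ofPred_eq, hQ.1.isFacet_section_iff (by rw [hQ.2.1]; omega) hv hw]
  have hkey : ∀ i : ℕ, i ≤ n - 1 → ∃ B, IsFacetIndex d n B ∧ 0 ∈ B ∧ (∃ k ∈ B, k ≠ 0) ∧
      B = if i = 0 then indexT d n 0 else indexE d n (i + 1) := by
    intro i hi
    by_cases h0 : i = 0
    · rw [if_pos h0]
      refine ⟨_, Or.inl ⟨0, by omega, rfl⟩, mem_indexT.2 ⟨le_rfl, ?_⟩,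
        ⟨e 0, mem_indexT.2 ?_, he0 0⟩, rfl⟩
      · rw [Fin.val_zero]; omega
      · rw [hev, Fin.val_zero]; omega
    · rw [if_neg h0]
      refine ⟨_, Or.inr ⟨i + 1, by omega, by omega, rfl⟩, Or.inl rfl, ⟨⟨i, by omega⟩, ?_,
        fun h => h0 (congrArg Fin.val h)⟩, rfl⟩
      rw [mem_indexE]
      simp only
      omega
  constructor
  · rintro ⟨F, hF, h0, rfl⟩
    obtain ⟨B, hB, rfl⟩ := (hQ.isFacet_iff hd).1 hF
    have h0B := hQ.1.mem_hull_iff.1 h0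
    have : ∃ i ≤ n - 1, B = if i = 0 then indexT d n 0 else indexE d n (i + 1) := by
      rcases hB with ⟨i, hi, rfl⟩ | ⟨j, h2, hj, rfl⟩
      · obtain rfl : i = 0 := by
          have := h0B.1
          rw [Fin.val_zero] at this
          omega
        exact ⟨0, by omega, (if_pos rfl).symm⟩
      · refine ⟨j - 1, by omega, ?_⟩
        rw [if_neg (by omega), Nat.sub_add_cancel (by omega)]
    obtain ⟨i, hi, hBi⟩ := this
    obtain ⟨B', -, -, hB', hBe⟩ := hkey i hi
    obtain rfl : B = B' := by rw [hBi, hBe]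
    exact ⟨i, by omega, by omega, by
      rw [multiplexFacet_eq y hd hn hi hBi e hev, hsec B h0B hB']⟩
  · rintro ⟨i, hi0, hi, rfl⟩
    lift i to ℕ using hi0
    obtain ⟨B, hB, h0B, hB', hBe⟩ := hkey i (by omega)
    exact ⟨_, hQ.isFacet hd hB, hQ.1.mem_hull_iff.2 h0B, by
      rw [multiplexFacet_eq y hd hn (by omega) hBe e hev, hsec B h0B hB']⟩

end

end Braxtope

theorem mainTheorem4 {E : Type*} [NormedAddCommGroup E] [NormedSpace ℝ E]
    [FiniteDimensional ℝ E] (d n : ℕ) (hd : 3 ≤ d) (hn : d ≤ n)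
    (x : Fin (n + 1) → E) (Q : Set E) (hQ : Braxtope.IsBraxtope d x Q) :
    Braxtope.IsBraxial d x Q ∧
    ((∃ S : Set E, Braxtope.IsVertexFigure Q (x 0) S) ∧
      ∀ S : Set E, Braxtope.IsVertexFigure Q (x 0) S →
        ∃ y : Fin ((n - 1) + 1) → E,
          (∀ i : Fin ((n - 1) + 1),
            y i ∈ segment ℝ (x 0) (Braxtope.vtx x ((i : ℕ) + 1)) ∩ S) ∧
          Braxtope.IsMultiplex (d - 1) y S) ∧
    (n + 3 ≤ 2 * d →
      ∃ (B : Set E) (m : ℕ) (σ : Fin (m + 1) ↪o Fin (n + 1)),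
        Braxtope.IsBraxtope (n - d + 2) (x ∘ σ) B ∧
        Braxtope.IsFoldPyramid (2 * d - 2 - n) Q B) ∧
    (∀ j : ℤ, -1 ≤ j → j ≤ d →
      Braxtope.faceCount Q j =
        Braxtope.binom (d + 1) (j + 1) +
          (n - d) * (Braxtope.binom (d - 1) j + Braxtope.binom (d - 2) (j - 1))) ∧
    Braxtope.IsElementary d Q :=
  ⟨hQ.isBraxial, ⟨hQ.1.exists_isVertexFigure, fun _ hS => hQ.isMultiplex_vertexFigure hd hS⟩,
    fun h => hQ.exists_isFoldPyramid (by omega) (by omega),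
    fun j hj _ => hQ.faceCount_binom hd j hj, hQ.isElementary hd⟩
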